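/- Let $\mathbb D$ be the open unit disc. We consider bounded simply connected domains $D\subset\mathbb C$ with $0\in D$ whose boundary $\partial D$ is a continuous curve (the image of a continuous map $[0,1]\to\mathbb C$). Let $\phi_D:\mathbb D\to D$ be the unique conformal map of $\mathbb D$ onto $D$ with $\phi_D(0)=0$ and $\phi_D'(0)>0$, extended continuously to $\overline{\mathbb D}$. Boundary points of $D$ are understood as prime ends, that is, a boundary point $z$ is given together with a point $z^*\in\partial\mathbb D$ such that $z=\phi_D(z^*)$; order on $\partial D$ means order of the points $z^*$, and the counterclockwise arc $\overline{zw}$ of $\partial D$ is the curve obtained by applying $\phi_D$ to the counterclockwise arc of $\partial\mathbb D$ from $z^*$ to $w^*$; its interior is the image of the open arc. Let $a,c,d$ be boundary points of $D$ with $a^*,c^*,d^*$ distinct and in counterclockwise order. $D$ is called *admissible* with respect to $(a,c,d)$ if the arcs $\overline{da}$, $\overline{ac}$, $\overline{cd}$ are simple curves (no double points, except that the two endpoints of an arc may coincide), $\overline{cd}$ does not meet the interior of $\overline{da}$ or of $\overline{ac}$, and from each point of $\overline{cd}$ there is a path to infinity that does not meet $\partial D$ after its starting point. For curves $\gamma_1,\gamma_2$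 put $\mathrm d(\gamma_1,\gamma_2)=\inf\sup_{t\in[0,1]}|\gamma_1(t)-\gamma_2(t)|$, the infimum being over all parametrizations of $\gamma_1,\gamma_2$ by $[0,1]$ (that respect their orientation). For four boundary points $z_1,\dots,z_4$ of $D$ such that $w_j=z_j^*$ are distinct and in counterclockwise order, Cardy's formula for a crossing inside $D$ from the counterclockwise arc $\overline{z_1z_2}$ to the counterclockwise arc $\overline{z_3z_4}$ is $$\Phi_D(z_1,z_2;z_3,z_4)=\frac{\Gamma(2/3)}{\Gamma(4/3)\Gamma(1/3)}\,\eta^{1/3}\,{}_2F_1(1/3,2/3;4/3;\eta),\qquad \eta=\frac{(w_1-w_2)(w_3-w_4)}{(w_1-w_3)(w_2-w_4)}\in(0,1).$$ **Lemma.** For $n\in\mathbb N$ let $D_n$ be such a domain, admissible with respect to boundary points $(a_n,c_n,d_n)$, and let $b_n$ belong to the interior of $\overline{c_nd_n}$; let $D$ be such a domain, admissible with respect to $(a,c,d)$, and let $b$ belong to the interior of $\overline{cd}$. Assume that, as $n\to\infty$, $b_n\to b$ (as points of $\mathbb C$) and the arcs $\overline{d_na_n}$, $\overline{a_nc_n}$,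 $\overline{c_nd_n}$ converge in the metric $\mathrm d$ to $\overline{da}$, $\overline{ac}$, $\overline{cd}$, respectively. Then $$\Phi_{D_n}(a_n,c_n;b_n,d_n)\longrightarrow\Phi_D(a,c;b,d)\qquad(n\to\infty).$$ -/

import Mathlib

open Set Filter Topology Metric

noncomputable section

namespace Cardy

/-- A bounded simply connected domain of the plane that contains the origin and whose boundary is
a continuous curve, i.e. the image of a continuous map from the unit interval. -/
structure IsCurveDomain (D : Set ℂ) : Prop where
  isOpen : IsOpen D
  isSimplyConnected : IsSimplyConnected D
  isBounded : Bornology.IsBounded D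
  zero_mem : (0 : ℂ) ∈ D
  boundary : ∃ g : unitInterval → ℂ, Continuous g ∧ range g = frontier D

/-- `φ` is, on the open unit disc, the (unique) conformal map of the disc onto `D` with
`φ 0 = 0` and `φ' 0 > 0`. Nothing is required of `φ` outside the open disc. -/
structure IsRiemannMap (D : Set ℂ) (φ : ℂ → ℂ) : Prop where
  differentiableOn : DifferentiableOn ℂ φ (ball 0 1)
  bijOn : BijOn φ (ball 0 1) D
  map_zero : φ 0 = 0
  deriv_pos : ∃ r : ℝ, 0 < r ∧ deriv φ 0 = (r : ℂ)

/-- The point of the unit circle with argument `θ`. -/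
def circlePt (θ : ℝ) : ℂ := Complex.exp (θ * Complex.I)

/-- The point of `∂D` (more accurately, the prime end of `D`) that corresponds to the point of the
unit circle with argument `θ`: the value there of the extension of `φ` by limits from inside
the disc. -/
def boundaryPt (φ : ℂ → ℂ) (θ : ℝ) : ℂ := extendFrom (ball 0 1) φ (circlePt θ)

/-- The counterclockwise boundary arc that corresponds to the arguments from `θ₁` to `θ₂`, for
`θ₁ < θ₂`, as a parametrized curve. -/
def boundaryArc (φ : ℂ → ℂ) (θ₁ θ₂ : ℝ) : unitInterval → ℂ :=
  fun t => boundaryPt φ ((1 - (t : ℝ)) * θ₁ + (t : ℝ) * θ₂)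

/-- A simple curve: continuous, without double points, except that the two endpoints may coincide
(a simple loop). -/
def IsSimpleCurve (J : unitInterval → ℂ) : Prop :=
  Continuous J ∧ ∀ s t : unitInterval, s < t → J s = J t → s = 0 ∧ t = 1

/-- From `z` there is a path to infinity that does not meet the set `B` after its start. -/
def HasPathToInfinity (B : Set ℂ) (z : ℂ) : Prop :=
  ∃ p : ℝ → ℂ, ContinuousOn p (Ici 0) ∧ p 0 = z ∧ Tendsto (fun t => ‖p t‖) atTop atTop ∧
    ∀ t : ℝ, 0 < t → p t ∉ B

/-- `D`, with Riemann map `φ`, is admissible with respect to the three boundary points (prime ends)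
`a`, `c`, `d`, in counterclockwise order, that correspond to the arguments `α < γ < δ < α + 2π`. The
arcs are `J₁ = da`, `J₂ = ac` and `J₃ = cd`. -/
structure IsAdmissible (D : Set ℂ) (φ : ℂ → ℂ) (α γ δ : ℝ) : Prop where
  domain : IsCurveDomain D
  riemannMap : IsRiemannMap D φ
  lt_ac : α < γ
  lt_cd : γ < δ
  lt_da : δ < α + 2 * Real.pi
  simple_da : IsSimpleCurve (boundaryArc φ δ (α + 2 * Real.pi))
  simple_ac : IsSimpleCurve (boundaryArc φ α γ)
  simple_cd : IsSimpleCurve (boundaryArc φ γ δ)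
  not_touch_da : ∀ s t : unitInterval, 0 < t → t < 1 →
    boundaryArc φ γ δ s ≠ boundaryArc φ δ (α + 2 * Real.pi) t
  not_touch_ac : ∀ s t : unitInterval, 0 < t → t < 1 →
    boundaryArc φ γ δ s ≠ boundaryArc φ α γ t
  path_to_infinity : ∀ s : unitInterval, HasPathToInfinity (frontier D) (boundaryArc φ γ δ s)

/-- The distance of two curves modulo (increasing) reparametrization: the infimum over
reparametrizations of both curves of the uniform distance. -/
def curveDist (J K : unitInterval → ℂ) : ENNReal :=
  ⨅ (f : unitInterval ≃o unitInterval) (g : unitInterval ≃o unitInterval),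
    ⨆ t : unitInterval, edist (J (f t)) (K (g t))

/-- The cross-ratio `η` of four points. -/
def crossRatio (w₁ w₂ w₃ w₄ : ℂ) : ℂ :=
  ((w₁ - w₂) * (w₃ - w₄)) / ((w₁ - w₃) * (w₂ - w₄))

/-- Cardy's formula as a function of the cross-ratio `η`. -/
def cardyFunction (η : ℝ) : ℝ :=
  Real.Gamma (2 / 3) / (Real.Gamma (4 / 3) * Real.Gamma (1 / 3)) * η ^ (1 / 3 : ℝ) *
    ordinaryHypergeometric (1 / 3 : ℝ) (2 / 3 : ℝ) (4 / 3 : ℝ) η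

/-- Cardy's formula `Φ_D(z₁, z₂; z₃, z₄)` for a crossing in `D` from the counterclockwise arc
`z₁z₂` to the counterclockwise arc `z₃z₄` of `∂D`, where `z₁, …, z₄` are the boundary points
that correspond under the Riemann map to the points of the unit circle with arguments
`θ₁, …, θ₄`. The cross-ratio of four points of the circle is real, see `crossRatio_circlePt`. -/
def cardyPhi (θ₁ θ₂ θ₃ θ₄ : ℝ) : ℝ :=
  cardyFunction (crossRatio (circlePt θ₁) (circlePt θ₂) (circlePt θ₃) (circlePt θ₄)).re

theorem circlePt_sub (x y : ℝ) :
    circlePt x - circlePt y =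
      2 * Complex.I * (Real.sin ((x - y) / 2) : ℂ) * Complex.exp (((x + y) / 2 : ℝ) * Complex.I) := by
  have h1 : (x : ℂ) * Complex.I
      = ((x + y) / 2 : ℝ) * Complex.I + ((x - y) / 2 : ℝ) * Complex.I := by push_cast; ring
  have h2 : (y : ℂ) * Complex.I
      = ((x + y) / 2 : ℝ) * Complex.I + (-((x - y) / 2 : ℝ)) * Complex.I := by push_cast; ring
  have h3 := Complex.two_sin (((x - y) / 2 : ℝ) : ℂ)
  unfold circlePt
  rw [h1, h2, Complex.exp_add, Complex.exp_add, Complex.ofReal_sin]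
  linear_combination (-Complex.I * Complex.exp (((x + y) / 2 : ℝ) * Complex.I)) * h3 -
    (Complex.exp (((x + y) / 2 : ℝ) * Complex.I)) * (Complex.exp (-(((x - y) / 2 : ℝ) : ℂ) * Complex.I)
      - Complex.exp ((((x - y) / 2 : ℝ) : ℂ) * Complex.I)) * Complex.I_sq

/-- The cross-ratio of four points of the unit circle is real. -/
theorem crossRatio_circlePt (x y z w : ℝ) :
    crossRatio (circlePt x) (circlePt y) (circlePt z) (circlePt w) =
      ((Real.sin ((x - y) / 2) * Real.sin ((z - w) / 2) /
        (Real.sin ((x - z) / 2) * Real.sin ((y - w) / 2)) : ℝ) : ℂ) := by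
  have h : Complex.exp (((x + y) / 2 : ℝ) * Complex.I) * Complex.exp (((z + w) / 2 : ℝ) * Complex.I)
      = Complex.exp (((x + z) / 2 : ℝ) * Complex.I) *
        Complex.exp (((y + w) / 2 : ℝ) * Complex.I) := by
    rw [← Complex.exp_add, ← Complex.exp_add]; congr 1; push_cast; ring
  unfold crossRatio
  rw [circlePt_sub, circlePt_sub, circlePt_sub, circlePt_sub,
    Complex.ofReal_div (Real.sin ((x - y) / 2) * Real.sin ((z - w) / 2)),
    Complex.ofReal_mul (Real.sin ((x - y) / 2)), Complex.ofReal_mul (Real.sin ((x - z) / 2))]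
  have hne : (2 * Complex.I) ^ 2 * (Complex.exp (((x + z) / 2 : ℝ) * Complex.I) *
        Complex.exp (((y + w) / 2 : ℝ) * Complex.I)) ≠ 0 := by
    simp [Complex.exp_ne_zero, Complex.I_ne_zero]
  symm
  rw [← mul_div_mul_left _ _ hne]
  congr 1
  · rw [← h]; ring
  · ring

end Cardy

end

/-! Cardy's formula depends continuously on the four points of the circle. So it is enough that the
arguments of `a_n`, `c_n`, `b_n`, `d_n`, after shifts by multiples of `2π`, converge to those of
`a`, `c`, `b`, `d`; by compactness only limits along subsequences have to be identified.

Closeness of the three arcs provides monotone functions `k n` that send the argument of a point of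
`∂D_n` to the argument of a nearby point of `∂D` and respect the subdivision into arcs
(`exists_isMatching`). Helly's theorem gives a monotone limit `K`, and off a countable set the
boundary values of `φ n` converge to `boundaryPt φ' ∘ K`. By Cauchy's formula the `φ n` then
converge locally uniformly in the disc, and the kernel argument (Hurwitz plus Schwarz,
`eqOn_of_kernel`) identifies the limit as `φ'`. Integrals of the boundary values over an arc of the
circle therefore have two expressions for their limit: one with `K`, by dominated convergence, and
one without `K`, because an arc can be pushed into the disc at a cost controlled by the supremum
alone. Differentiating, `boundaryPt φ' t = boundaryPt φ' (K t)` at continuity points of `K`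
(`boundaryPt_eq`).

Admissibility now makes `K` trivial. Points of the open arc `cd`, except possibly `a`, are not
double points, so `K` is the identity modulo `2π` there; and `K` is constant on no interval, since
the boundary curve is constant on none. A marked point `c`, `d` or `a` with a wrong limit would
create such an interval (`C_eq`, `limits_eq`); `b` is located by the simplicity of `cd`.

The continuous extension of the Riemann maps to the circle is Carathéodory's theorem. It rests on
the length-area estimate, the uniform local connectedness of a continuous curve, and Janiszewski's
separation theorem, the latter by way of Eilenberg's criterion on continuous logarithms. -/

noncomputable section

namespace Cardy

/-! ### Separation of points of the plane by compact sets -/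

/-- The function `z ↦ (z - a) / (z - b)` has a continuous logarithm on `K`. -/
def HasLogRatio (K : Set ℂ) (a b : ℂ) : Prop :=
  ∃ L : ℂ → ℂ, ContinuousOn L K ∧ ∀ z ∈ K, Complex.exp (L z) * (z - b) = z - a

theorem HasLogRatio.symm {K : Set ℂ} {a b : ℂ} (h : HasLogRatio K a b) : HasLogRatio K b a := by
  obtain ⟨L, hL, h⟩ := h
  refine ⟨fun z => -L z, hL.neg, fun z hz => ?_⟩
  rw [← h z hz, ← mul_assoc, ← Complex.exp_add]
  simp

theorem HasLogRatio.trans {K : Set ℂ} {a b c : ℂ} (h : HasLogRatio K a b)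
    (h' : HasLogRatio K b c) : HasLogRatio K a c := by
  obtain ⟨L, hL, h⟩ := h
  obtain ⟨L', hL', h'⟩ := h'
  refine ⟨fun z => L z + L' z, hL.add hL', fun z hz => ?_⟩
  rw [← h z hz, ← h' z hz, Complex.exp_add, mul_assoc]

/-- Two continuous functions on a preconnected set with the same exponential differ by a constant. -/
theorem sub_eq_sub_of_exp_eq {X : Type*} [TopologicalSpace X] {S : Set X} (hS : IsPreconnected S)
    {f g : X → ℂ} (hf : ContinuousOn f S) (hg : ContinuousOn g S)
    (h : ∀ x ∈ S, Complex.exp (f x) = Complex.exp (g x)) {x y : X} (hx : x ∈ S) (hy : y ∈ S) :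
    f x - g x = f y - g y := by
  refine Complex.isCoveringMap_exp.constOn_of_comp (g := fun x => f x - g x) hS (hf.sub hg)
    (fun a ha b hb => ?_) hx hy
  simp only [Complex.exp_sub, h a ha, h b hb]
  simp [Complex.exp_ne_zero]

/-- On the connected overlap the two logarithms differ by a constant `c` with `exp c = 1`; shifting
one by `c` glues them. With Eilenberg's criterion this is Janiszewski's theorem: two compact sets
with connected intersection, neither separating two points, do not separate them together. -/
theorem HasLogRatio.union {A B : Set ℂ} {a b : ℂ} (hA : IsClosed A) (hB : IsClosed B)
    (hAB : IsPreconnected (A ∩ B)) (hb : b ∉ A ∩ B)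
    (hla : HasLogRatio A a b) (hlb : HasLogRatio B a b) : HasLogRatio (A ∪ B) a b := by
  classical
  obtain ⟨L, hL, h⟩ := hla
  obtain ⟨L', hL', h'⟩ := hlb
  have key : ∀ z ∈ A ∩ B, Complex.exp (L z) = Complex.exp (L' z) := fun z hz => by
    have hzb : z - b ≠ 0 := sub_ne_zero.2 (fun e => hb (e ▸ hz))
    exact mul_right_cancel₀ hzb ((h z hz.1).trans (h' z hz.2).symm)
  obtain ⟨c, hc, hcL⟩ : ∃ c : ℂ, Complex.exp c = 1 ∧ ∀ z ∈ A ∩ B, L z = L' z + c := by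
    rcases (A ∩ B).eq_empty_or_nonempty with he | ⟨y, hy⟩
    · exact ⟨0, by simp, by simp [he]⟩
    · refine ⟨L y - L' y, by rw [Complex.exp_sub, key y hy, div_self (Complex.exp_ne_zero _)],
        fun z hz => ?_⟩
      rw [← sub_eq_sub_of_exp_eq hAB (hL.mono inter_subset_left) (hL'.mono inter_subset_right) key
        hz hy]
      ring
  refine ⟨fun z => if z ∈ A then L z else L' z + c, ?_, fun z hz => ?_⟩
  · refine ContinuousOn.union_of_isClosed (hL.congr fun z hz => by simp [hz])
      ((hL'.add (continuousOn_const (c := c))).congr fun z hz => ?_) hA hB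
    by_cases hzA : z ∈ A
    · simp [hzA, hcL z ⟨hzA, hz⟩]
    · simp [hzA]
  · by_cases hzA : z ∈ A
    · simpa [hzA] using h z hzA
    · simpa [hzA, Complex.exp_add, hc] using h' z (hz.resolve_left hzA)

/-- If two points lie in a connected open set disjoint from the compact set `K`, then
`(z - a) / (z - b)` has a continuous logarithm on `K`. -/
theorem hasLogRatio_of_isPreconnected {K U : Set ℂ} (hK : IsCompact K) (hU : IsPreconnected U)
    (hKU : Disjoint K U) {a b : ℂ} (ha : a ∈ U) (hb : b ∈ U) : HasLogRatio K a b := by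
  -- The relation is symmetric and transitive, so on a connected set it only has to hold between
  -- nearby points.
  refine hU.induction₂ (fun a b => HasLogRatio K a b) (fun x hx => ?_)
    (fun x y z _ _ _ h h' => h.trans h') (fun x y _ _ h => h.symm) ha hb
  have hxK : x ∉ K := fun h => hKU.le_bot ⟨h, hx⟩
  obtain ⟨ε, hε, hball⟩ := Metric.isOpen_iff.1 hK.isClosed.isOpen_compl x hxK
  filter_upwards [mem_nhdsWithin_of_mem_nhds (ball_mem_nhds x hε)] with y hy
  have hne : ∀ z ∈ K, z - x ≠ 0 := fun z hz => sub_ne_zero.2 (fun e => hxK (e ▸ hz))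
  refine HasLogRatio.symm ⟨fun z => Complex.log ((z - y) / (z - x)), ?_, fun z hz => ?_⟩
  -- For `y` nearer to `x` than `K` is, the quotient stays at distance less than `1` from `1`, so
  -- the principal logarithm is continuous.
  · refine ContinuousOn.clog (ContinuousOn.div (by fun_prop) (by fun_prop) hne) fun z hz => ?_
    have e : (z - y) / (z - x) = 1 + (x - y) / (z - x) := by
      field_simp [hne z hz]; ring
    rw [e]
    refine Complex.mem_slitPlane_of_norm_lt_one ?_
    rw [norm_div, div_lt_one (norm_pos_iff.2 (hne z hz))]
    have h1 : ε ≤ ‖z - x‖ := by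
      by_contra hlt
      exact hball (by simpa [dist_eq_norm] using hlt) hz
    have h2 : ‖x - y‖ < ε := by simpa [dist_comm, dist_eq_norm] using hy
    linarith
  · rw [Complex.exp_log]
    · field_simp [hne z hz]
    · refine div_ne_zero (sub_ne_zero.2 ?_) (hne z hz)
      rintro rfl
      exact hball hy hz

theorem isPreconnected_compl_closedBall (c : ℂ) (R : ℝ) : IsPreconnected (closedBall c R)ᶜ := by
  have h : (closedBall c R)ᶜ =
      (fun p : ℝ × ℝ => c + p.1 * Complex.exp (p.2 * Complex.I)) '' ((Ioi R ∩ Ici 0) ×ˢ univ) := by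
    ext z
    constructor
    · intro hz
      refine ⟨(‖z - c‖, Complex.arg (z - c)), ⟨⟨?_, norm_nonneg _⟩, trivial⟩, ?_⟩
      · simpa [dist_eq_norm] using hz
      · simp [Complex.norm_mul_exp_arg_mul_I]
    · rintro ⟨⟨r, θ⟩, ⟨hr, -⟩, rfl⟩
      have h0 : 0 ≤ r := hr.2
      have h1 : R < r := hr.1
      simpa [dist_eq_norm, Complex.norm_exp_ofReal_mul_I, abs_of_nonneg h0] using h1
  rw [h]
  refine IsPreconnected.image ?_ _ (by fun_prop)
  exact (Set.ordConnected_Ioi.inter Set.ordConnected_Ici).isPreconnected.prod isPreconnected_univ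

/-- There is no continuous logarithm of `z - a` on a circle around `a`. -/
theorem not_exists_log_on_circle {a : ℂ} {R : ℝ} (hR : 0 < R) (G : ℂ → ℂ) (hG : Continuous G)
    (h : ∀ θ : ℝ, Complex.exp (G (a + R * Complex.exp (θ * Complex.I))) =
      R * Complex.exp (θ * Complex.I)) : False := by
  have hR' : (R : ℂ) ≠ 0 := by exact_mod_cast hR.ne'
  -- Compare with the explicit lift `log R + iθ`: the difference would be constant, yet between `0`
  -- and `2π` the lift gains `2πi` while `G` returns to its value.
  have := sub_eq_sub_of_exp_eq (S := (univ : Set ℝ)) isPreconnected_univ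
    (f := fun θ : ℝ => G (a + R * Complex.exp (θ * Complex.I)))
    (g := fun θ : ℝ => Complex.log R + θ * Complex.I) (by fun_prop) (by fun_prop)
    (fun θ _ => by rw [h, Complex.exp_add, Complex.exp_log hR'])
    (mem_univ 0) (mem_univ (2 * Real.pi))
  simp [Complex.exp_two_pi_mul_I, Real.pi_ne_zero] at this

theorem frontier_connectedComponentIn_subset {K : Set ℂ} (hK : IsClosed K) (a : ℂ) :
    frontier (connectedComponentIn Kᶜ a) ⊆ K := by
  intro z hz
  by_contra hzK
  have hopen : IsOpen (connectedComponentIn Kᶜ z) := hK.isOpen_compl.connectedComponentIn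
  have hmem : z ∈ connectedComponentIn Kᶜ z := mem_connectedComponentIn hzK
  obtain ⟨w, hw, hw'⟩ := mem_closure_iff.1 (frontier_subset_closure hz) _ hopen hmem
  have e : connectedComponentIn Kᶜ a = connectedComponentIn Kᶜ z :=
    (connectedComponentIn_eq hw').trans (connectedComponentIn_eq hw).symm
  have ho : IsOpen (connectedComponentIn Kᶜ a) := hK.isOpen_compl.connectedComponentIn
  rw [ho.frontier_eq] at hz
  exact hz.2 (e ▸ hmem)

/-- Suppose `b` is outside the bounded component `U` of `a`. Extend the logarithm to the plane by
Tietze and glue `exp (L' z) * (z - b)` on `U` to `z - a` off `U`; they agree on the frontier, which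
lies in `K`. The result is continuous and zero-free on the plane, so it has a logarithm, although it
equals `z - a` on a large circle around `a`. -/
theorem mem_connectedComponentIn_of_hasLogRatio_of_isBounded {K : Set ℂ} (hK : IsCompact K)
    {a b : ℂ} (ha : a ∉ K) (h : HasLogRatio K a b)
    (hbd : Bornology.IsBounded (connectedComponentIn Kᶜ a)) :
    b ∈ connectedComponentIn Kᶜ a := by
  classical
  by_contra hbU
  set U := connectedComponentIn Kᶜ a with hU
  have haU : a ∈ U := mem_connectedComponentIn ha
  obtain ⟨L, hL, hLe⟩ := h
  obtain ⟨L', hL'⟩ := ContinuousMap.exists_restrict_eq hK.isClosed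
    (⟨K.domRestrict L, continuousOn_iff_continuous_domRestrict.1 hL⟩ : C(K, ℂ))
  have hLL' : ∀ z ∈ K, L' z = L z := fun z hz => by
    have := congrArg (fun f : C(K, ℂ) => f ⟨z, hz⟩) hL'
    simpa using! this
  set F : ℂ → ℂ := fun z => if z ∈ U then Complex.exp (L' z) * (z - b) else z - a with hF
  have hFc : Continuous F := by
    refine Continuous.if (fun z hz => ?_) (by fun_prop) (by fun_prop)
    have hzK : z ∈ K := frontier_connectedComponentIn_subset hK.isClosed a hz
    rw [hLL' z hzK, hLe z hzK]
  have hF0 : ∀ z, F z ≠ 0 := fun z => by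
    by_cases hz : z ∈ U
    · simp only [hF, hz, if_true]
      exact mul_ne_zero (Complex.exp_ne_zero _) (sub_ne_zero.2 fun e => hbU (e ▸ hz))
    · simp only [hF, hz, if_false]
      exact sub_ne_zero.2 fun e => hz (e ▸ haU)
  have huniv : IsSimplyConnected (univ : Set ℂ) := by
    have : ContractibleSpace (univ : Set ℂ) := convex_univ.contractibleSpace univ_nonempty
    exact SimplyConnectedSpace.ofContractible _
  obtain ⟨G, hG, hGe⟩ := Complex.exists_continuousOn_eqOn_exp_comp huniv isOpen_univ
    hFc.continuousOn (by rintro ⟨z, -, hz⟩; exact hF0 z hz)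
  obtain ⟨R, hR⟩ := hbd.subset_ball a
  have hR0 : 0 < R := by
    have := hR haU
    simpa using this
  refine not_exists_log_on_circle (a := a) hR0 G (continuousOn_univ.1 hG) fun θ => ?_
  have hout : a + R * Complex.exp (θ * Complex.I) ∉ U := fun hmem => by
    have := hR hmem
    simp [Complex.norm_exp_ofReal_mul_I, abs_of_pos hR0] at this
  have := hGe (mem_univ (a + R * Complex.exp (θ * Complex.I)))
  simpa [hF, hout] using this

/-- Eilenberg's criterion: a compact set `K` on which `(z - a) / (z - b)` has a continuous logarithm
does not separate `a` from `b`. -/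
theorem mem_connectedComponentIn_of_hasLogRatio {K : Set ℂ} (hK : IsCompact K)
    {a b : ℂ} (ha : a ∉ K) (hb : b ∉ K) (h : HasLogRatio K a b) :
    b ∈ connectedComponentIn Kᶜ a := by
  by_cases h1 : Bornology.IsBounded (connectedComponentIn Kᶜ a)
  · exact mem_connectedComponentIn_of_hasLogRatio_of_isBounded hK ha h h1
  by_cases h2 : Bornology.IsBounded (connectedComponentIn Kᶜ b)
  · have := mem_connectedComponentIn_of_hasLogRatio_of_isBounded hK hb h.symm h2
    rw [← connectedComponentIn_eq this]
    exact mem_connectedComponentIn hb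
  obtain ⟨R, hR⟩ := hK.isBounded.subset_closedBall 0
  -- An unbounded component contains the whole exterior of a large disc, so there is only one.
  have key : ∀ c, ¬ Bornology.IsBounded (connectedComponentIn Kᶜ c) →
      (closedBall 0 R)ᶜ ⊆ connectedComponentIn Kᶜ c := fun c hc => by
    obtain ⟨z, hz, hz'⟩ : ∃ z ∈ connectedComponentIn Kᶜ c, z ∉ closedBall (0 : ℂ) R := by
      by_contra! hcon
      exact hc (isBounded_closedBall.subset hcon)
    rw [connectedComponentIn_eq hz]
    exact (isPreconnected_compl_closedBall 0 R).subset_connectedComponentIn hz'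
      (compl_subset_compl.2 hR)
  have hz : ((|R| + 1 : ℝ) : ℂ) ∈ (closedBall (0 : ℂ) R)ᶜ := by
    have := le_abs_self R
    simp only [mem_compl_iff, mem_closedBall, dist_zero_right, Complex.norm_real, Real.norm_eq_abs]
    rw [abs_of_nonneg (by positivity)]
    linarith
  rw [connectedComponentIn_eq (key a h1 hz), ← connectedComponentIn_eq (key b h2 hz)]
  exact mem_connectedComponentIn hb

/-! ### The length-area estimate -/

/-- This is `|re^{iθ} - 1|² = 1 + r(r - 2 cos θ)`. Centring the disc at `1` puts the boundary point
under study at `0`, where circles around it are polar coordinate lines. -/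
theorem mul_exp_mem_ball_one_iff {r θ : ℝ} (hr : 0 < r) :
    (r : ℂ) * Complex.exp (θ * Complex.I) ∈ ball (1 : ℂ) 1 ↔ r < 2 * Real.cos θ := by
  rw [mem_ball, dist_eq_norm, ← sq_lt_one_iff₀ (norm_nonneg _), ← Complex.normSq_eq_norm_sq,
    Complex.exp_mul_I, ← Complex.ofReal_cos, ← Complex.ofReal_sin, Complex.normSq_apply]
  have h : ((r : ℂ) * (Real.cos θ + Real.sin θ * Complex.I) - 1).re *
      ((r : ℂ) * (Real.cos θ + Real.sin θ * Complex.I) - 1).re +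
      ((r : ℂ) * (Real.cos θ + Real.sin θ * Complex.I) - 1).im *
      ((r : ℂ) * (Real.cos θ + Real.sin θ * Complex.I) - 1).im = 1 + r * (r - 2 * Real.cos θ) := by
    have hsc := Real.sin_sq_add_cos_sq θ
    generalize Real.cos θ = c at hsc ⊢
    generalize Real.sin θ = s at hsc ⊢
    simp
    linear_combination r ^ 2 * hsc
  rw [h]
  constructor
  · intro h1
    by_contra h2
    nlinarith [mul_nonneg hr.le (sub_nonneg.2 (not_lt.1 h2))]
  · intro h1
    nlinarith [mul_pos hr (sub_pos.2 h1)]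

/-- The cosine is unimodal on `(-π, π)`; hence a circle around `0` meets `ball 1 1` in a single arc.
-/
theorem cos_le_of_mem_Icc {a b θ : ℝ} (ha : -Real.pi < a) (hb : b < Real.pi) (hθ : θ ∈ Icc a b) :
    min (Real.cos a) (Real.cos b) ≤ Real.cos θ := by
  rcases le_total 0 θ with h | h
  · exact (min_le_right _ _).trans (Real.cos_le_cos_of_nonneg_of_le_pi h hb.le hθ.2)
  · refine (min_le_left _ _).trans ?_
    rw [← Real.cos_neg a, ← Real.cos_neg θ]
    exact Real.cos_le_cos_of_nonneg_of_le_pi (by linarith) (by linarith) (by linarith [hθ.1])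

open MeasureTheory in
-- The real Jacobian of a holomorphic map is the squared modulus of its derivative.
theorem lintegral_norm_deriv_sq {F : ℂ → ℂ} {U : Set ℂ} (hU : IsOpen U)
    (hF : DifferentiableOn ℂ F U) (hinj : InjOn F U) :
    ∫⁻ z in U, ENNReal.ofReal (‖deriv F z‖ ^ 2) = volume (F '' U) := by
  have h := lintegral_image_eq_lintegral_abs_det_fderiv_mul (volume : Measure ℂ) hU.measurableSet
    (f := F) (f' := fun z => (ContinuousLinearMap.toSpanSingleton ℂ (deriv F z)).restrictScalars ℝ)
    (fun z hz => ((hF.differentiableAt (hU.mem_nhds hz)).hasDerivAt.hasFDerivAt.restrictScalars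
      ℝ).hasFDerivWithinAt) hinj (fun _ => 1)
  simp only [lintegral_const, one_mul, mul_one, Measure.restrict_apply MeasurableSet.univ,
    univ_inter] at h
  rw [h]
  refine lintegral_congr fun z => ?_
  congr 1
  simp [ContinuousLinearMap.det, LinearMap.det_restrictScalars, Algebra.norm_complex_eq,
    Complex.normSq_eq_norm_sq]

open MeasureTheory in
-- Otherwise polar coordinates would bound the integral of `g` below by that of `c / r` over `(0,
-- R)`, which diverges.
theorem exists_lintegral_circle_lt {g : ℂ → ENNReal} (hg : Measurable g)
    (hfin : ∫⁻ z, g z ≠ ⊤) {c R : ℝ} (hc : 0 < c) (hR : 0 < R) :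
    ∃ r ∈ Ioo 0 R, ∫⁻ θ in Ioo (-Real.pi) Real.pi, g (r * Complex.exp (θ * Complex.I)) <
      ENNReal.ofReal (c / r ^ 2) := by
  by_contra! hcon
  have hpolar := Complex.lintegral_comp_polarCoord_symm g
  have hrw : ∫⁻ p in polarCoord.target, ENNReal.ofReal p.1 • g (Complex.polarCoord.symm p) =
      ∫⁻ r in Ioi (0 : ℝ), ∫⁻ θ in Ioo (-Real.pi) Real.pi,
        ENNReal.ofReal r * g (r * Complex.exp (θ * Complex.I)) := by
    rw [polarCoord_target, Measure.volume_eq_prod, ← Measure.prod_restrict, lintegral_prod]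
    · simp [Complex.polarCoord_symm_apply, Complex.exp_mul_I]
    · have : (fun p : ℝ × ℝ => ENNReal.ofReal p.1 • g (Complex.polarCoord.symm p)) =
          fun p : ℝ × ℝ => ENNReal.ofReal p.1 *
            g (p.1 * (Real.cos p.2 + Real.sin p.2 * Complex.I)) := by
        ext p; simp [Complex.polarCoord_symm_apply]
      rw [this]
      refine Measurable.aemeasurable ?_
      refine (ENNReal.measurable_ofReal.comp measurable_fst).mul (hg.comp ?_)
      exact Continuous.measurable (by fun_prop)
  have hle : ∫⁻ r in Ioo 0 R, ENNReal.ofReal (c * r⁻¹) ≤ ∫⁻ z, g z := by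
    rw [← hpolar, hrw]
    refine le_trans ?_ (lintegral_mono_set (s := Ioo 0 R) fun r hr => hr.1)
    refine setLIntegral_mono' measurableSet_Ioo fun r hr => ?_
    rw [lintegral_const_mul]
    · refine le_trans ?_ (mul_le_mul_right (hcon r hr) _)
      rw [← ENNReal.ofReal_mul hr.1.le]
      refine ENNReal.ofReal_le_ofReal (le_of_eq ?_)
      have := hr.1.ne'
      field_simp
    · exact hg.comp (Continuous.measurable (by fun_prop))
  have hint : IntegrableOn (fun r : ℝ => c * r⁻¹) (Ioo 0 R) := by
    refine ⟨Measurable.aestronglyMeasurable (by fun_prop), ?_⟩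
    rw [hasFiniteIntegral_iff_ofReal]
    · exact lt_of_le_of_lt hle (lt_top_iff_ne_top.2 hfin)
    · filter_upwards [ae_restrict_mem measurableSet_Ioo] with r hr
      have := hr.1
      simp only [Pi.zero_apply]
      positivity
  have hint' : IntervalIntegrable (fun r : ℝ => r⁻¹) volume 0 R := by
    rw [intervalIntegrable_iff_integrableOn_Ioo_of_le hR.le]
    have := hint.const_mul c⁻¹
    refine this.congr (ae_of_all _ fun r => ?_)
    field_simp
  rw [intervalIntegrable_inv_iff] at hint'
  rcases hint' with h | h
  · exact hR.ne h
  · exact h (by simp)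

open MeasureTheory in
/-- On arbitrarily small circles around the boundary point `0` of `ball 1 1`, an injective
holomorphic function with bounded image has arbitrarily small oscillation. -/
theorem exists_small_crosscut {F : ℂ → ℂ} (hF : DifferentiableOn ℂ F (ball 1 1))
    (hinj : InjOn F (ball 1 1)) (hbd : Bornology.IsBounded (F '' ball 1 1))
    {ε R : ℝ} (hε : 0 < ε) (hR : 0 < R) :
    ∃ r ∈ Ioo 0 R, ∀ z ∈ ball (1 : ℂ) 1, ∀ w ∈ ball (1 : ℂ) 1, ‖z‖ = r → ‖w‖ = r →
      dist (F z) (F w) ≤ ε := by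
  set g : ℂ → ENNReal := (ball (1 : ℂ) 1).indicator fun z => ENNReal.ofReal (‖deriv F z‖ ^ 2)
    with hgdef
  have hg : Measurable g := by
    refine Measurable.indicator ?_ measurableSet_ball
    exact ENNReal.measurable_ofReal.comp ((measurable_deriv F).norm.pow_const 2)
  have hfin : ∫⁻ z, g z ≠ ⊤ := by
    rw [hgdef, lintegral_indicator measurableSet_ball, lintegral_norm_deriv_sq isOpen_ball hF hinj]
    exact hbd.measure_lt_top.ne
  -- Below, `r x ≤ l / 2 + r² x² / (2 l)` takes the place of Cauchy–Schwarz; with this `l`, and the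
  -- circle integral at most `l ε / r²`, each of the two terms contributes `ε / 2`.
  set l : ℝ := ε / (2 * Real.pi) with hl
  have hpi := Real.pi_pos
  have hl0 : 0 < l := by positivity
  obtain ⟨r, hr, hA⟩ := exists_lintegral_circle_lt hg hfin (mul_pos hl0 hε) hR
  have hr0 : 0 < r := hr.1
  refine ⟨r, hr, ?_⟩
  have key : ∀ a b : ℝ, -Real.pi < a → a ≤ b → b < Real.pi →
      (r : ℂ) * Complex.exp (a * Complex.I) ∈ ball (1 : ℂ) 1 →
      (r : ℂ) * Complex.exp (b * Complex.I) ∈ ball (1 : ℂ) 1 →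
      dist (F (r * Complex.exp (b * Complex.I))) (F (r * Complex.exp (a * Complex.I))) ≤ ε := by
    intro a b ha hab hb haF hbF
    have hmem : ∀ θ ∈ Icc a b, (r : ℂ) * Complex.exp (θ * Complex.I) ∈ ball (1 : ℂ) 1 := by
      intro θ hθ
      rw [mul_exp_mem_ball_one_iff hr0] at haF hbF ⊢
      have := cos_le_of_mem_Icc ha hb hθ
      rcases min_le_iff.1 this with h | h <;> linarith
    have hcirc : Continuous fun θ : ℝ => (r : ℂ) * Complex.exp (θ * Complex.I) := by fun_prop
    have hdF : ContinuousOn (deriv F) (ball 1 1) := (hF.deriv isOpen_ball).continuousOn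
    have hdc : ContinuousOn (fun θ : ℝ => deriv F (r * Complex.exp (θ * Complex.I))) (Icc a b) :=
      hdF.comp hcirc.continuousOn hmem
    have hder : ∀ θ ∈ uIcc a b, HasDerivAt (fun θ : ℝ => F (r * Complex.exp (θ * Complex.I)))
        (deriv F (r * Complex.exp (θ * Complex.I)) *
          (r * (Complex.exp (θ * Complex.I) * Complex.I))) θ := by
      intro θ hθ
      rw [uIcc_of_le hab] at hθ
      have h1 := (hF.differentiableAt (isOpen_ball.mem_nhds (hmem θ hθ))).hasDerivAt
      have h2 : HasDerivAt (fun θ : ℝ => (r : ℂ) * Complex.exp (θ * Complex.I))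
          (r * (Complex.exp (θ * Complex.I) * Complex.I)) θ := by
        have := ((Complex.ofRealCLM.hasDerivAt (x := θ)).mul_const Complex.I).cexp.const_mul (r : ℂ)
        simpa using! this
      exact h1.comp θ h2
    have hcont : ContinuousOn (fun θ : ℝ => deriv F (r * Complex.exp (θ * Complex.I)) *
          (r * (Complex.exp (θ * Complex.I) * Complex.I))) (uIcc a b) := by
      rw [uIcc_of_le hab]
      exact hdc.mul (Continuous.continuousOn (by fun_prop))
    have hFTC := intervalIntegral.integral_eq_sub_of_hasDerivAt hder hcont.intervalIntegrable
    have hsqc : ContinuousOn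
        (fun θ : ℝ => ‖deriv F (r * Complex.exp (θ * Complex.I))‖ ^ 2) (Icc a b) :=
      hdc.norm.pow 2
    have hsqi : IntervalIntegrable
        (fun θ : ℝ => ‖deriv F (r * Complex.exp (θ * Complex.I))‖ ^ 2) volume a b := by
      refine ContinuousOn.intervalIntegrable ?_
      rwa [uIcc_of_le hab]
    have hsq : ∫ θ in a..b, ‖deriv F (r * Complex.exp (θ * Complex.I))‖ ^ 2 ≤ l * ε / r ^ 2 := by
      rw [intervalIntegral.integral_of_le hab]
      have h1 : ENNReal.ofReal (∫ θ in Ioc a b, ‖deriv F (r * Complex.exp (θ * Complex.I))‖ ^ 2) ≤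
          ENNReal.ofReal (l * ε / r ^ 2) := by
        rw [ofReal_integral_eq_lintegral_ofReal]
        · refine le_trans ?_ hA.le
          refine le_trans ?_ (lintegral_mono_set (s := Ioc a b) fun θ hθ =>
            ⟨ha.trans hθ.1, hθ.2.trans_lt hb⟩)
          refine setLIntegral_mono' measurableSet_Ioc fun θ hθ => ?_
          rw [hgdef, indicator_of_mem (hmem θ (Ioc_subset_Icc_self hθ))]
        · exact (intervalIntegrable_iff_integrableOn_Ioc_of_le hab).1 hsqi
        · exact ae_of_all _ fun θ => by positivity
      exact (ENNReal.ofReal_le_ofReal_iff (by positivity)).1 h1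
    rw [dist_eq_norm, ← hFTC]
    calc ‖∫ θ in a..b, deriv F (r * Complex.exp (θ * Complex.I)) *
          (r * (Complex.exp (θ * Complex.I) * Complex.I))‖
        ≤ ∫ θ in a..b,
          (l / 2 + r ^ 2 / (2 * l) * ‖deriv F (r * Complex.exp (θ * Complex.I))‖ ^ 2) := by
          refine intervalIntegral.norm_integral_le_of_norm_le hab (ae_of_all _ fun θ _ => ?_)
            (intervalIntegrable_const.add (hsqi.const_mul _))
          rw [norm_mul, norm_mul, norm_mul, Complex.norm_exp_ofReal_mul_I, Complex.norm_I,
            Complex.norm_real, Real.norm_of_nonneg hr0.le]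
          set x := ‖deriv F (r * Complex.exp (θ * Complex.I))‖
          have e : l / 2 + r ^ 2 / (2 * l) * x ^ 2 - x * (r * (1 * 1)) =
              (l - r * x) ^ 2 / (2 * l) := by field_simp; ring
          have : 0 ≤ (l - r * x) ^ 2 / (2 * l) := by positivity
          linarith
      _ = (b - a) * (l / 2) + r ^ 2 / (2 * l) *
            ∫ θ in a..b, ‖deriv F (r * Complex.exp (θ * Complex.I))‖ ^ 2 := by
          rw [intervalIntegral.integral_add intervalIntegrable_const (hsqi.const_mul _),
            intervalIntegral.integral_const, intervalIntegral.integral_const_mul, smul_eq_mul]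
      _ ≤ (2 * Real.pi) * (l / 2) + r ^ 2 / (2 * l) * (l * ε / r ^ 2) := by
          gcongr
          linarith
      _ = ε := by
          rw [hl]; field_simp; ring
  intro z hz w hw hzr hwr
  have hz' : (r : ℂ) * Complex.exp (z.arg * Complex.I) = z := by
    rw [← hzr, Complex.norm_mul_exp_arg_mul_I]
  have hw' : (r : ℂ) * Complex.exp (w.arg * Complex.I) = w := by
    rw [← hwr, Complex.norm_mul_exp_arg_mul_I]
  have harg : ∀ v : ℂ, v ∈ ball (1 : ℂ) 1 → (r : ℂ) * Complex.exp (v.arg * Complex.I) = v →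
      v.arg < Real.pi := by
    intro v hv hv'
    refine lt_of_le_of_ne (Complex.arg_le_pi v) fun h => ?_
    rw [← hv', mul_exp_mem_ball_one_iff hr0, h, Real.cos_pi] at hv
    linarith
  rcases le_total z.arg w.arg with h | h
  · have := key z.arg w.arg (Complex.neg_pi_lt_arg z) h (harg w hw hw') (by rwa [hz']) (by rwa [hw'])
    rwa [hz', hw', dist_comm] at this
  · have := key w.arg z.arg (Complex.neg_pi_lt_arg w) h (harg z hz hz') (by rwa [hw']) (by rwa [hz'])
    rwa [hz', hw'] at this

/-! ### Injective holomorphic maps of the disc -/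

theorem isOpen_image_of_injOn {φ : ℂ → ℂ} (hφ : DifferentiableOn ℂ φ (ball 0 1))
    (hinj : InjOn φ (ball 0 1)) {s : Set ℂ} (hs : s ⊆ ball 0 1) (hso : IsOpen s) :
    IsOpen (φ '' s) := by
  rcases (hφ.analyticOnNhd isOpen_ball).is_constant_or_isOpen
    (convex_ball (0 : ℂ) 1).isPreconnected with ⟨w, hw⟩ | h
  · have h0 : (0 : ℂ) ∈ ball (0 : ℂ) 1 := by simp
    have h1 : (1 / 2 : ℂ) ∈ ball (0 : ℂ) 1 := by simp; norm_num
    have := hinj h0 h1 ((hw 0 h0).trans (hw _ h1).symm)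
    norm_num at this
  · exact h s hs hso

/-- The inverse of an injective holomorphic function on the disc is holomorphic. -/
theorem exists_holomorphic_inverse {φ : ℂ → ℂ} (hφ : DifferentiableOn ℂ φ (ball 0 1))
    (hinj : InjOn φ (ball 0 1)) :
    ∃ ψ : ℂ → ℂ, DifferentiableOn ℂ ψ (φ '' ball 0 1) ∧ ∀ z ∈ ball (0 : ℂ) 1, ψ (φ z) = z := by
  set ψ := Function.invFunOn φ (ball 0 1) with hψ
  have hleft : ∀ z ∈ ball (0 : ℂ) 1, ψ (φ z) = z := fun z hz => hinj.leftInvOn_invFunOn hz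
  have hcont : ∀ z ∈ ball (0 : ℂ) 1, ContinuousAt ψ (φ z) := by
    intro z hz
    rw [ContinuousAt, hleft z hz]
    intro s hs
    obtain ⟨t, hts, hto, hzt⟩ := _root_.mem_nhds_iff.1 (inter_mem hs (isOpen_ball.mem_nhds hz))
    have ho := isOpen_image_of_injOn hφ hinj (fun w hw => (hts hw).2) hto
    refine mem_map.2 (mem_of_superset (ho.mem_nhds ⟨z, hzt, rfl⟩) ?_)
    rintro _ ⟨w, hw, rfl⟩
    simpa [hleft w (hts hw).2] using (hts hw).1
  have hright : ∀ w ∈ φ '' ball 0 1, φ (ψ w) = w := by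
    rintro _ ⟨z, hz, rfl⟩
    rw [hleft z hz]
  have hopen : IsOpen (φ '' ball 0 1) := isOpen_image_of_injOn hφ hinj subset_rfl isOpen_ball
  refine ⟨ψ, ?_, hleft⟩
  rintro _ ⟨z, hz, rfl⟩
  refine DifferentiableAt.differentiableWithinAt (AnalyticAt.differentiableAt ?_)
  -- It suffices that zeros of `deriv φ` are isolated: the continuous inverse is differentiable off
  -- their images, and the singularities there are removable.
  refine Complex.analyticAt_of_differentiable_on_punctured_nhds_of_continuousAt ?_ (hcont z hz)
  have hder : ∀ᶠ w in 𝓝[≠] z, deriv φ w ≠ 0 := by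
    have han := (hφ.analyticOnNhd isOpen_ball).deriv z hz
    rcases han.eventually_eq_zero_or_eventually_ne_zero with h | h
    · exfalso
      obtain ⟨ε, hε, hb⟩ := Metric.eventually_nhds_iff_ball.1
        (h.and (isOpen_ball.mem_nhds hz))
      obtain ⟨w, hw, hwz⟩ : ∃ w ∈ ball z ε, w ≠ z := by
        refine ⟨z + (ε / 2 : ℝ), ?_, ?_⟩
        · simp only [mem_ball, dist_self_add_left, Complex.norm_real, Real.norm_eq_abs]
          rw [abs_of_pos (half_pos hε)]; linarith
        · simp [hε.ne']
      have := (convex_ball z ε).is_const_of_fderivWithin_eq_zero (𝕜 := ℂ) (f := φ)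
        (hφ.mono fun w hw => (hb w hw).2) (fun w hw => ?_) hw (mem_ball_self hε)
      · exact hwz (hinj (hb w hw).2 hz this)
      · rw [fderivWithin_of_isOpen isOpen_ball hw]
        ext
        simp [(hb w hw).1]
    · exact h
  have hψt : Tendsto ψ (𝓝[≠] φ z) (𝓝[≠] z) := by
    refine tendsto_nhdsWithin_iff.2 ⟨?_, ?_⟩
    · have := (hcont z hz).tendsto
      rw [hleft z hz] at this
      exact this.mono_left nhdsWithin_le_nhds
    · filter_upwards [self_mem_nhdsWithin,
        mem_nhdsWithin_of_mem_nhds (hopen.mem_nhds ⟨z, hz, rfl⟩)] with w hw hwD hcon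
      apply hw
      rw [mem_singleton_iff, ← hright w hwD, hcon]
  filter_upwards [hψt.eventually hder,
    mem_nhdsWithin_of_mem_nhds (hopen.mem_nhds ⟨z, hz, rfl⟩)] with w hw hwD
  obtain ⟨v, hv, rfl⟩ := hwD
  rw [hleft v hv] at hw
  refine (HasDerivAt.of_local_left_inverse (f := φ) (f' := deriv φ v) (hcont v hv) ?_ hw
    ?_).differentiableAt
  · rw [hleft v hv]
    exact (hφ.differentiableAt (isOpen_ball.mem_nhds hv)).hasDerivAt
  · filter_upwards [hopen.mem_nhds ⟨v, hv, rfl⟩] with w hw using hright w hw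

theorem subset_of_disjoint_frontier {X : Type*} [TopologicalSpace X] {V D : Set X}
    (hV : IsPreconnected V) (hD : IsOpen D) (hne : (V ∩ D).Nonempty)
    (hdisj : Disjoint V (frontier D)) : V ⊆ D := by
  refine hV.subset_of_closure_inter_subset hD hne fun x hx => ?_
  by_contra hxD
  exact disjoint_left.1 hdisj hx.2 (by rw [hD.frontier_eq]; exact ⟨hx.1, hxD⟩)

/-! ### Boundary extension of conformal maps -/

/-- On the compact set of parameter pairs at distance at least `η` from all coincidences `g q.1 = g
q.2`, the distance of the two values has a positive lower bound `ρ`. So if `g s` and `g t` are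
closer than `ρ`, then `(s, t)` is near some `(s', t')` with `g s' = g t'`, and the images of short
intervals around `s'` and `t'` share that value. -/
theorem exists_isPreconnected_of_dist_lt {g : unitInterval → ℂ} (hg : Continuous g) {ε : ℝ}
    (hε : 0 < ε) : ∃ ρ > 0, ∀ s t, dist (g s) (g t) < ρ → ∃ C ⊆ range g, IsPreconnected C ∧
      g s ∈ C ∧ g t ∈ C ∧ C ⊆ closedBall (g s) ε := by
  obtain ⟨η, hη, hu⟩ := Metric.uniformContinuous_iff.1
    (CompactSpace.uniformContinuous_of_continuous hg) (ε / 4) (by positivity)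
  set K : Set (unitInterval × unitInterval) :=
    {p | ∀ q : unitInterval × unitInterval, g q.1 = g q.2 → η ≤ dist p q}
  have hK : IsCompact K := by
    have : K = ⋂ q : unitInterval × unitInterval, ⋂ _ : g q.1 = g q.2, {p | η ≤ dist p q} := by
      ext p; simp [K]
    rw [this]
    exact (isClosed_iInter fun q => isClosed_iInter fun _ =>
      isClosed_le continuous_const (by fun_prop)).isCompact
  obtain ⟨ρ, hρ, hmin⟩ := hK.exists_forall_le' (f := fun p => dist (g p.1) (g p.2)) (a := 0)
    (Continuous.continuousOn (by fun_prop)) (fun p hp => by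
      rw [dist_pos]
      intro h
      have := hp p h
      rw [dist_self] at this
      linarith)
  refine ⟨ρ, hρ, fun s t hst => ?_⟩
  have hp : (s, t) ∉ K := fun h => (hmin _ h).not_gt hst
  simp only [K, mem_ofPred_eq, not_forall, not_le] at hp
  obtain ⟨⟨s', t'⟩, heq, hd⟩ := hp
  rw [Prod.dist_eq, max_lt_iff] at hd
  have hball : ∀ u : unitInterval, IsPreconnected (ball u η) := fun u => by
    have : ball u η = Subtype.val ⁻¹' (ball (u : ℝ) η) := rfl
    rw [this, Real.ball_eq_Ioo]
    exact (ordConnected_Ioo.preimage_mono (Subtype.mono_coe _)).isPreconnected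
  refine ⟨g '' ball s' η ∪ g '' ball t' η, ?_, ?_, .inl ⟨s, hd.1, rfl⟩, .inr ⟨t, hd.2, rfl⟩, ?_⟩
  · exact union_subset (image_subset_range _ _) (image_subset_range _ _)
  · refine IsPreconnected.union (g s') ⟨s', mem_ball_self hη, rfl⟩ ?_
      ((hball s').image _ hg.continuousOn) ((hball t').image _ hg.continuousOn)
    exact ⟨t', mem_ball_self hη, heq.symm⟩
  · have h1 : dist (g s') (g s) < ε / 4 := by rw [dist_comm]; exact hu hd.1
    have heq' : g s' = g t' := heq
    rintro _ (⟨u, hus, rfl⟩ | ⟨u, hut, rfl⟩)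
    · have h2 := hu (a := u) (b := s') hus
      rw [mem_closedBall]
      linarith [dist_triangle (g u) (g s') (g s)]
    · have h2 := hu (a := u) (b := t') hut
      rw [mem_closedBall]
      rw [← heq'] at h2
      linarith [dist_triangle (g u) (g s') (g s)]

/-- A continuous curve is uniformly locally connected. -/
theorem exists_isClosed_isPreconnected {g : unitInterval → ℂ} (hg : Continuous g) {ε : ℝ}
    (hε : 0 < ε) : ∃ ρ > 0, ∀ x ∈ range g, ∃ E ⊆ range g, IsClosed E ∧ IsPreconnected E ∧
      E ⊆ closedBall x ε ∧ range g ∩ ball x ρ ⊆ E := by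
  obtain ⟨ρ, hρ, h⟩ := exists_isPreconnected_of_dist_lt hg hε
  refine ⟨ρ, hρ, ?_⟩
  rintro _ ⟨s, rfl⟩
  set S : Set (Set ℂ) := {C | C ⊆ range g ∧ IsPreconnected C ∧ g s ∈ C ∧ C ⊆ closedBall (g s) ε}
  refine ⟨closure (⋃₀ S), ?_, isClosed_closure, ?_, ?_, ?_⟩
  · exact closure_minimal (sUnion_subset fun C hC => hC.1) (isCompact_range hg).isClosed
  · exact (isPreconnected_sUnion (g s) S (fun C hC => hC.2.2.1) fun C hC => hC.2.1).closure
  · exact closure_minimal (sUnion_subset fun C hC => hC.2.2.2) isClosed_closedBall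
  · rintro _ ⟨⟨t, rfl⟩, ht⟩
    obtain ⟨C, hC, hCc, hs, ht', hCb⟩ := h s t (by rw [dist_comm]; exact ht)
    exact subset_closure ⟨C, ⟨hC, hCc, hs, hCb⟩, ht'⟩

/-- The substitution `z = ζ (1 - w)` reduces the oscillation to `exists_small_crosscut`. If the
closed image missed the frontier it would be a compact subset of the domain with compact preimage in
the open disc; but the preimage contains the crosscut, which reaches the unit circle. -/
theorem exists_crosscut {φ : ℂ → ℂ} (hφ : DifferentiableOn ℂ φ (ball 0 1))
    (hinj : InjOn φ (ball 0 1)) (hbd : Bornology.IsBounded (φ '' ball 0 1)) {ζ : ℂ} (hζ : ‖ζ‖ = 1)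
    {ε : ℝ} (hε : 0 < ε) :
    ∃ r ∈ Ioo (0 : ℝ) 1,
      (∀ z ∈ ball (0 : ℂ) 1 ∩ sphere ζ r, ∀ w ∈ ball (0 : ℂ) 1 ∩ sphere ζ r,
        dist (φ z) (φ w) ≤ ε) ∧
      (closure (φ '' (ball 0 1 ∩ sphere ζ r)) ∩ frontier (φ '' ball 0 1)).Nonempty := by
  have hζ0 : ζ ≠ 0 := norm_ne_zero_iff.1 (by rw [hζ]; exact one_ne_zero)
  have hmaps : ∀ w : ℂ, w ∈ ball (1 : ℂ) 1 ↔ ζ * (1 - w) ∈ ball (0 : ℂ) 1 := fun w => by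
    simp [hζ, dist_eq_norm, norm_sub_rev]
  have himg : (fun w => φ (ζ * (1 - w))) '' ball 1 1 ⊆ φ '' ball 0 1 := by
    rintro _ ⟨w, hw, rfl⟩
    exact ⟨_, (hmaps w).1 hw, rfl⟩
  obtain ⟨r, hr, hosc⟩ := exists_small_crosscut (F := fun w => φ (ζ * (1 - w)))
    (hφ.comp (Differentiable.differentiableOn (by fun_prop)) fun w hw => (hmaps w).1 hw)
    (fun w hw v hv h => by
      have := mul_left_cancel₀ hζ0 (hinj ((hmaps w).1 hw) ((hmaps v).1 hv) h)
      linear_combination -this) (hbd.subset himg) hε one_pos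
  refine ⟨r, hr, ?_, ?_⟩
  · rintro z ⟨hz, hzr⟩ w ⟨hw, hwr⟩
    have hconv : ∀ v : ℂ, ζ * (1 - (1 - v / ζ)) = v := fun v => by field_simp; ring
    have hnorm : ∀ v : ℂ, v ∈ sphere ζ r → ‖1 - v / ζ‖ = r := fun v hv => by
      have e : 1 - v / ζ = (ζ - v) / ζ := by field_simp
      rw [e, norm_div, hζ, div_one, norm_sub_rev, ← dist_eq_norm]
      exact hv
    have := hosc (1 - z / ζ) ((hmaps _).2 (by rwa [hconv])) (1 - w / ζ)
      ((hmaps _).2 (by rwa [hconv])) (hnorm z hzr) (hnorm w hwr)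
    simpa only [hconv] using this
  · have hr0 := hr.1
    set A := closure (φ '' (ball 0 1 ∩ sphere ζ r)) with hA
    have hAcl : A ⊆ closure (φ '' ball 0 1) := closure_mono (image_mono inter_subset_left)
    have hAc : IsCompact A := (hbd.closure.subset hAcl).isCompact_closure.of_isClosed_subset
      isClosed_closure subset_closure
    by_contra hempty
    have hopen := isOpen_image_of_injOn hφ hinj subset_rfl isOpen_ball
    have hAD : A ⊆ φ '' ball 0 1 := fun y hy => by
      by_contra hyD
      refine hempty ⟨y, hy, ?_⟩
      rw [hopen.frontier_eq]
      exact ⟨hAcl hy, hyD⟩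
    obtain ⟨ψ, hψ, hleft⟩ := exists_holomorphic_inverse hφ hinj
    have hP : IsCompact (ψ '' A) := hAc.image_of_continuousOn (hψ.continuousOn.mono hAD)
    have hPb : ψ '' A ⊆ ball 0 1 := by
      rintro _ ⟨y, hy, rfl⟩
      obtain ⟨z, hz, rfl⟩ := hAD hy
      rwa [hleft z hz]
    -- The angle at which the circle of radius `r` leaves the disc, where `r = 2 cos θ₀`.
    set θ₀ := Real.arccos (r / 2) with hθ₀
    have hcosθ₀ : Real.cos θ₀ = r / 2 := Real.cos_arccos (by linarith [hr.1]) (by linarith [hr.2])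
    have hθ₀pos : 0 < θ₀ := Real.arccos_pos.2 (by linarith [hr.2])
    set c : ℝ → ℂ := fun θ => ζ * (1 - r * Complex.exp (θ * Complex.I)) with hc
    have hcc : Continuous c := by fun_prop
    have hcmem : ∀ θ ∈ Ioo 0 θ₀, c θ ∈ ψ '' A := by
      intro θ hθ
      have hcb : c θ ∈ ball (0 : ℂ) 1 := by
        rw [hc, ← hmaps, mul_exp_mem_ball_one_iff hr0]
        have := Real.cos_lt_cos_of_nonneg_of_le_pi hθ.1.le (Real.arccos_le_pi _) hθ.2
        rw [hcosθ₀] at this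
        linarith
      refine ⟨φ (c θ), subset_closure ⟨c θ, ⟨hcb, ?_⟩, rfl⟩, hleft _ hcb⟩
      rw [mem_sphere, dist_eq_norm]
      have : c θ - ζ = -(ζ * (r * Complex.exp (θ * Complex.I))) := by simp only [hc]; ring
      rw [this, norm_neg, norm_mul, norm_mul, hζ, Complex.norm_exp_ofReal_mul_I, Complex.norm_real,
        Real.norm_of_nonneg hr0.le]
      ring
    have hlim : c θ₀ ∈ ψ '' A := by
      refine hP.isClosed.mem_of_tendsto (hcc.continuousAt.tendsto.mono_left nhdsWithin_le_nhds :
        Tendsto c (𝓝[<] θ₀) _) ?_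
      filter_upwards [Ioo_mem_nhdsLT hθ₀pos] with θ hθ using hcmem θ hθ
    have := hPb hlim
    rw [hc, ← hmaps, mul_exp_mem_ball_one_iff hr0, hcosθ₀] at this
    linarith

/-- Carathéodory: a conformal map of the disc onto a bounded domain whose boundary is a continuous
curve is uniformly continuous near each point of the unit circle. -/
theorem exists_ball_dist_le {φ : ℂ → ℂ} (hφ : DifferentiableOn ℂ φ (ball 0 1))
    (hinj : InjOn φ (ball 0 1)) (hbd : Bornology.IsBounded (φ '' ball 0 1))
    {g : unitInterval → ℂ} (hg : Continuous g) (hgr : range g = frontier (φ '' ball 0 1))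
    {ζ : ℂ} (hζ : ‖ζ‖ = 1) {ε : ℝ} (hε : 0 < ε) :
    ∃ r > 0, ∃ x, ∀ z ∈ ball (0 : ℂ) 1 ∩ ball ζ r, dist (φ z) x ≤ ε := by
  set D := φ '' ball 0 1 with hD
  have hopen : IsOpen D := isOpen_image_of_injOn hφ hinj subset_rfl isOpen_ball
  have hpre : IsPreconnected D := (convex_ball (0 : ℂ) 1).isPreconnected.image _ hφ.continuousOn
  have h0 : φ 0 ∈ D := ⟨0, by simp, rfl⟩
  obtain ⟨d, hd, hdD⟩ := Metric.isOpen_iff.1 hopen _ h0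
  set ε₁ := min ε (d / 2) with hε₁
  have hε₁0 : 0 < ε₁ := lt_min hε (half_pos hd)
  obtain ⟨ρ, hρ, hE⟩ := exists_isClosed_isPreconnected hg hε₁0
  obtain ⟨r, hr, hosc, x, hxA, hxD⟩ := exists_crosscut hφ hinj hbd hζ
    (lt_min hε₁0 (half_pos hρ))
  obtain ⟨E, hEr, hEc, hEp, hEb, hEx⟩ := hE x (hgr ▸ hxD)
  refine ⟨r, hr.1, x, ?_⟩
  by_contra! hcon
  obtain ⟨z, ⟨hz, hzr⟩, hzx⟩ := hcon
  set A₀ := closure (φ '' (ball 0 1 ∩ sphere ζ r)) with hA₀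
  have hA₀x : A₀ ⊆ closedBall x (min ε₁ (ρ / 2)) := by
    intro y hy
    have h1 : ∀ w ∈ ball (0 : ℂ) 1 ∩ sphere ζ r, dist (φ w) x ≤ min ε₁ (ρ / 2) := by
      intro w hw
      have : A₀ ⊆ closedBall (φ w) (min ε₁ (ρ / 2)) := by
        refine closure_minimal ?_ isClosed_closedBall
        rintro _ ⟨v, hv, rfl⟩
        exact hosc v hv w hw
      rw [dist_comm]
      exact this hxA
    refine closure_minimal (t := closedBall x (min ε₁ (ρ / 2))) ?_ isClosed_closedBall hy
    rintro _ ⟨v, hv, rfl⟩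
    exact h1 v hv
  have hA₀cl : A₀ ⊆ closure D := closure_mono (image_mono inter_subset_left)
  have hA₀c : IsCompact A₀ := (isCompact_closedBall x _).of_isClosed_subset isClosed_closure hA₀x
  have hA : IsCompact (A₀ ∪ E) :=
    hA₀c.union ((isCompact_closedBall x _).of_isClosed_subset hEc hEb)
  have hAb : A₀ ∪ E ⊆ closedBall x ε₁ :=
    union_subset (hA₀x.trans (closedBall_subset_closedBall (min_le_left _ _))) hEb
  have hBc : IsCompact (frontier D) := by
    rw [← hgr]; exact isCompact_range hg
  -- The crosscut `A₀` lies within `ρ / 2` of `x`, and `E` contains all of the frontier that close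
  -- to `x`. Thus the overlap is the connected set `E`, as Janiszewski's theorem requires.
  have hinter : (A₀ ∪ E) ∩ frontier D = E := by
    refine Subset.antisymm ?_ fun y hy => ⟨.inr hy, hgr ▸ hEr hy⟩
    rintro y ⟨hy | hy, hyD⟩
    · refine hEx ⟨hgr ▸ hyD, ?_⟩
      have := (mem_closedBall.1 (hA₀x hy)).trans (min_le_right _ _)
      exact mem_ball.2 (this.trans_lt (half_lt_self hρ))
    · exact hy
  have hnotD : ∀ y ∈ frontier D, y ∉ D := fun y hy => by
    rw [hopen.frontier_eq] at hy; exact hy.2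
  have h0x : φ 0 ∉ closedBall x ε₁ := fun h => by
    have h1 : x ∉ ball (φ 0) d := fun hx => hnotD x hxD (hdD hx)
    rw [mem_ball, not_lt, dist_comm] at h1
    have h2 := (mem_closedBall.1 h).trans (min_le_right _ _)
    linarith
  have hzx' : φ z ∉ closedBall x ε₁ := fun h =>
    ((mem_closedBall.1 h).trans (min_le_left _ _)).not_gt hzx
  have hzD : φ z ∈ D := ⟨z, hz, rfl⟩
  -- Neither set separates `φ 0` from `φ z`: the first lies in a disc that contains neither point,
  -- the second is disjoint from the connected set `D`.
  have hlogA : HasLogRatio (A₀ ∪ E) (φ 0) (φ z) :=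
    hasLogRatio_of_isPreconnected hA (isPreconnected_compl_closedBall x ε₁)
      (disjoint_compl_right.mono_left hAb) h0x hzx'
  have hlogB : HasLogRatio (frontier D) (φ 0) (φ z) :=
    hasLogRatio_of_isPreconnected hBc hpre
      (disjoint_left.2 hnotD) h0 hzD
  have hlog : HasLogRatio ((A₀ ∪ E) ∪ frontier D) (φ 0) (φ z) :=
    hlogA.union hA.isClosed hBc.isClosed (by rwa [hinter]) (fun h => hnotD _ h.2 hzD) hlogB
  have hmem := mem_connectedComponentIn_of_hasLogRatio (hA.union hBc)
    (fun h => h.elim (fun h => h0x (hAb h)) fun h => hnotD _ h h0)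
    (fun h => h.elim (fun h => hzx' (hAb h)) fun h => hnotD _ h hzD) hlog
  set V := connectedComponentIn ((A₀ ∪ E) ∪ frontier D)ᶜ (φ 0) with hV
  have hVsub : V ⊆ ((A₀ ∪ E) ∪ frontier D)ᶜ := connectedComponentIn_subset _ _
  have h0V : φ 0 ∈ V := mem_connectedComponentIn (fun h =>
    h.elim (fun h => h0x (hAb h)) fun h => hnotD _ h h0)
  have hVpre : IsPreconnected V := isPreconnected_connectedComponentIn
  have hVD : V ⊆ D := subset_of_disjoint_frontier hVpre hopen ⟨_, h0V, h0⟩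
    (disjoint_left.2 fun w hw hwD => hVsub hw (.inr hwD))
  obtain ⟨ψ, hψ, hleft⟩ := exists_holomorphic_inverse hφ hinj
  -- Pulled back to the disc, `V` joins `0` to `z` without meeting the circle of radius `r` around
  -- `ζ`, although that circle separates them.
  have himg : IsPreconnected (ψ '' V) := hVpre.image _ (hψ.continuousOn.mono hVD)
  have hoff : ∀ w ∈ ψ '' V, dist w ζ ≠ r := by
    rintro _ ⟨y, hy, rfl⟩ hwr
    obtain ⟨v, hv, rfl⟩ := hVD hy
    rw [hleft v hv] at hwr
    exact hVsub hy (.inl (.inl (subset_closure ⟨v, ⟨hv, hwr⟩, rfl⟩)))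
  have hz' : z ∈ ψ '' V := ⟨φ z, hmem, hleft z hz⟩
  have h0' : (0 : ℂ) ∈ ψ '' V := ⟨φ 0, h0V, hleft 0 (by simp)⟩
  obtain ⟨w, hw, hwr⟩ := himg.intermediate_value hz' h0'
    (f := fun w => dist w ζ) (Continuous.continuousOn (by fun_prop))
    (show r ∈ Icc _ _ from ⟨le_of_lt hzr, by simpa [hζ] using hr.2.le⟩)
  exact hoff w hw hwr

theorem exists_tendsto_of_norm_eq_one {φ : ℂ → ℂ} (hφ : DifferentiableOn ℂ φ (ball 0 1))
    (hinj : InjOn φ (ball 0 1)) (hbd : Bornology.IsBounded (φ '' ball 0 1))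
    {g : unitInterval → ℂ} (hg : Continuous g) (hgr : range g = frontier (φ '' ball 0 1))
    {ζ : ℂ} (hζ : ‖ζ‖ = 1) : ∃ y, Tendsto φ (𝓝[ball 0 1] ζ) (𝓝 y) := by
  have hmem : ζ ∈ closure (ball (0 : ℂ) 1) := by
    rw [closure_ball _ one_ne_zero]; simp [hζ]
  have : (𝓝[ball (0 : ℂ) 1] ζ).NeBot := mem_closure_iff_nhdsWithin_neBot.1 hmem
  refine CompleteSpace.complete (Metric.cauchy_iff.2 ⟨inferInstance, fun ε hε => ?_⟩)
  obtain ⟨r, hr, x, hx⟩ := exists_ball_dist_le hφ hinj hbd hg hgr hζ (ε := ε / 3) (by positivity)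
  refine ⟨closedBall x (ε / 3), ?_, fun y hy z hz => ?_⟩
  · have : ball (0 : ℂ) 1 ∩ ball ζ r ∈ 𝓝[ball (0 : ℂ) 1] ζ :=
      inter_mem self_mem_nhdsWithin (mem_nhdsWithin_of_mem_nhds (ball_mem_nhds ζ hr))
    exact mem_map.2 (mem_of_superset this fun z hz => hx z hz)
  · have := dist_triangle_right y z x
    rw [mem_closedBall] at hy hz
    linarith

/-! ### The boundary values as a continuous periodic parametrization of the frontier. -/

theorem norm_circlePt (θ : ℝ) : ‖circlePt θ‖ = 1 := Complex.norm_exp_ofReal_mul_I θ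

theorem continuous_circlePt : Continuous circlePt := by unfold circlePt; fun_prop

theorem circlePt_add_int_mul (θ : ℝ) (m : ℤ) : circlePt (θ + m * (2 * Real.pi)) = circlePt θ := by
  unfold circlePt
  rw [Complex.exp_eq_exp_iff_exists_int]
  exact ⟨m, by push_cast; ring⟩

theorem boundaryPt_add_int_mul (φ : ℂ → ℂ) (θ : ℝ) (m : ℤ) :
    boundaryPt φ (θ + m * (2 * Real.pi)) = boundaryPt φ θ := by
  rw [boundaryPt, circlePt_add_int_mul, boundaryPt]

theorem boundaryPt_add_two_pi (φ : ℂ → ℂ) (θ : ℝ) :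
    boundaryPt φ (θ + 2 * Real.pi) = boundaryPt φ θ := by
  simpa using boundaryPt_add_int_mul φ θ 1

section Extension

variable {D : Set ℂ} {φ : ℂ → ℂ}

theorem IsRiemannMap.image_eq (hφ : IsRiemannMap D φ) : φ '' ball 0 1 = D := hφ.bijOn.image_eq

theorem continuousOn_extendFrom_closedBall (hD : IsCurveDomain D) (hφ : IsRiemannMap D φ) :
    ContinuousOn (extendFrom (ball 0 1) φ) (closedBall 0 1) := by
  refine continuousOn_extendFrom (by rw [closure_ball _ one_ne_zero]) fun ζ hζ => ?_
  rcases (mem_closedBall_zero_iff.1 hζ).lt_or_eq with h | h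
  · exact ⟨φ ζ, (hφ.differentiableOn.continuousOn ζ (mem_ball_zero_iff.2 h)).tendsto⟩
  · obtain ⟨g, hg, hgr⟩ := hD.boundary
    exact exists_tendsto_of_norm_eq_one hφ.differentiableOn hφ.bijOn.injOn
      (by rw [hφ.image_eq]; exact hD.isBounded) hg (by rw [hgr, hφ.image_eq]) h

theorem extendFrom_eq_of_mem_ball (hφ : IsRiemannMap D φ) {z : ℂ} (hz : z ∈ ball (0 : ℂ) 1) :
    extendFrom (ball 0 1) φ z = φ z :=
  extendFrom_extends hφ.differentiableOn.continuousOn z hz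

theorem continuous_boundaryPt (hD : IsCurveDomain D) (hφ : IsRiemannMap D φ) :
    Continuous (boundaryPt φ) :=
  (continuousOn_extendFrom_closedBall hD hφ).comp_continuous continuous_circlePt fun θ => by
    simp [norm_circlePt]

theorem tendsto_boundaryPt (hD : IsCurveDomain D) (hφ : IsRiemannMap D φ) (θ : ℝ) :
    Tendsto φ (𝓝[ball 0 1] circlePt θ) (𝓝 (boundaryPt φ θ)) := by
  have h := (continuousOn_extendFrom_closedBall hD hφ (circlePt θ) (by simp [norm_circlePt])).mono
    ball_subset_closedBall
  refine h.tendsto.congr' ?_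
  filter_upwards [self_mem_nhdsWithin] with z hz using extendFrom_eq_of_mem_ball hφ hz

theorem neBot_nhdsWithin_circlePt (θ : ℝ) : (𝓝[ball 0 1] circlePt θ).NeBot := by
  rw [← mem_closure_iff_nhdsWithin_neBot, closure_ball _ one_ne_zero]
  simp [norm_circlePt]

/-- If the limit were in `D`, the continuous inverse would send the approaching values to an
interior point of the disc, whereas it returns `u`, which tends to the circle. -/
theorem boundaryPt_mem_frontier (hD : IsCurveDomain D) (hφ : IsRiemannMap D φ) (θ : ℝ) :
    boundaryPt φ θ ∈ frontier D := by
  have hne := neBot_nhdsWithin_circlePt θ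
  have ht := tendsto_boundaryPt hD hφ θ
  rw [hD.isOpen.frontier_eq]
  refine ⟨mem_closure_of_tendsto ht ?_, fun hmem => ?_⟩
  · filter_upwards [self_mem_nhdsWithin] with z hz using hφ.bijOn.mapsTo hz
  · obtain ⟨z, hz, hzθ⟩ := hφ.bijOn.surjOn hmem
    obtain ⟨ψ, hψ, hleft⟩ := exists_holomorphic_inverse hφ.differentiableOn hφ.bijOn.injOn
    rw [hφ.image_eq] at hψ
    have hc : ContinuousAt ψ (boundaryPt φ θ) :=
      hψ.continuousOn.continuousAt (hD.isOpen.mem_nhds hmem)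
    have h1 : Tendsto (fun u => ψ (φ u)) (𝓝[ball 0 1] circlePt θ) (𝓝 z) := by
      have := hc.tendsto.comp ht
      rwa [← hzθ, hleft z hz] at this
    have h2 : Tendsto (fun u => ψ (φ u)) (𝓝[ball 0 1] circlePt θ) (𝓝 (circlePt θ)) := by
      refine (tendsto_id.mono_left nhdsWithin_le_nhds).congr' ?_
      filter_upwards [self_mem_nhdsWithin] with u hu using (hleft u hu).symm
    have := tendsto_nhds_unique h1 h2
    rw [this, mem_ball_zero_iff, norm_circlePt] at hz
    exact lt_irrefl _ hz

theorem exists_boundaryPt_eq (hD : IsCurveDomain D) (hφ : IsRiemannMap D φ) {y : ℂ}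
    (hy : y ∈ frontier D) : ∃ θ, boundaryPt φ θ = y := by
  have hK : IsCompact (extendFrom (ball 0 1) φ '' closedBall 0 1) :=
    (isCompact_closedBall (0 : ℂ) 1).image_of_continuousOn (continuousOn_extendFrom_closedBall hD hφ)
  have hDK : D ⊆ extendFrom (ball 0 1) φ '' closedBall 0 1 := by
    intro w hw
    obtain ⟨z, hz, rfl⟩ := hφ.bijOn.surjOn hw
    exact ⟨z, ball_subset_closedBall hz, extendFrom_eq_of_mem_ball hφ hz⟩
  rw [hD.isOpen.frontier_eq] at hy
  obtain ⟨w, hw, rfl⟩ := closure_minimal hDK hK.isClosed hy.1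
  have hw1 : ‖w‖ = 1 := by
    refine le_antisymm (mem_closedBall_zero_iff.1 hw) (not_lt.1 fun h => hy.2 ?_)
    have hb : w ∈ ball (0 : ℂ) 1 := mem_ball_zero_iff.2 h
    rw [extendFrom_eq_of_mem_ball hφ hb]
    exact hφ.bijOn.mapsTo hb
  refine ⟨w.arg, ?_⟩
  rw [boundaryPt, circlePt]
  congr 1
  simpa [hw1] using Complex.norm_mul_exp_arg_mul_I w

end Extension

/-- Helly's selection theorem: a uniformly bounded sequence of monotone functions has a subsequence
that converges to a monotone function at the points of continuity of the latter. -/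
theorem exists_subseq_tendsto_of_monotone {k : ℕ → ℝ → ℝ} (hk : ∀ n, Monotone (k n)) {a b : ℝ}
    (hab : ∀ n t, k n t ∈ Icc a b) :
    ∃ κ : ℕ → ℕ, StrictMono κ ∧ ∃ K : ℝ → ℝ, Monotone K ∧ (∀ t, K t ∈ Icc a b) ∧
      ∀ t, ContinuousAt K t → Tendsto (fun n => k (κ n) t) atTop (𝓝 (K t)) := by
  -- Compactness of a countable product replaces the diagonal argument and gives convergence at all
  -- rationals; `K t` is then the infimum of the limits at rationals beyond `t`.
  obtain ⟨l, hl, κ, hκ, hlim⟩ := (isCompact_univ_pi fun _ : ℚ => isCompact_Icc (a := a)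
    (b := b)).tendsto_subseq (x := fun n (q : ℚ) => k n q) fun n q _ => hab n q
  have hlq : ∀ q : ℚ, Tendsto (fun n => k (κ n) q) atTop (𝓝 (l q)) := fun q =>
    (tendsto_pi_nhds.1 hlim) q
  have hlab : ∀ q, l q ∈ Icc a b := fun q => hl q (mem_univ q)
  set K : ℝ → ℝ := fun t => sInf (l '' {q : ℚ | t < q}) with hK
  have hne : ∀ t : ℝ, (l '' {q : ℚ | t < q}).Nonempty := fun t => by
    obtain ⟨q, hq⟩ := exists_rat_gt t
    exact ⟨l q, q, hq, rfl⟩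
  have hbdd : ∀ t : ℝ, BddBelow (l '' {q : ℚ | t < q}) := fun t =>
    ⟨a, by rintro _ ⟨q, -, rfl⟩; exact (hlab q).1⟩
  have hlmono : ∀ p q : ℚ, p ≤ q → l p ≤ l q := fun p q hpq =>
    le_of_tendsto_of_tendsto' (hlq p) (hlq q) fun n => hk _ (by exact_mod_cast hpq)
  have hKle : ∀ (t : ℝ) (q : ℚ), t < q → K t ≤ l q := fun t q h =>
    csInf_le (hbdd t) ⟨q, h, rfl⟩
  have hleK : ∀ (t : ℝ) (q : ℚ), (q : ℝ) ≤ t → l q ≤ K t := fun t q h => by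
    refine le_csInf (hne t) ?_
    rintro _ ⟨p, hp, rfl⟩
    have hp' : t < p := hp
    exact hlmono q p (by exact_mod_cast (h.trans_lt hp').le)
  refine ⟨κ, hκ, K, fun s t hst => ?_, fun t => ⟨?_, ?_⟩, fun t ht => ?_⟩
  · refine csInf_le_csInf (hbdd s) (hne t) (image_mono fun q hq => ?_)
    exact lt_of_le_of_lt hst hq
  · refine le_csInf (hne t) ?_
    rintro _ ⟨q, -, rfl⟩
    exact (hlab q).1
  · obtain ⟨q, hq⟩ := exists_rat_gt t
    exact (hKle t q hq).trans (hlab q).2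
  · refine tendsto_order.2 ⟨fun x hx => ?_, fun x hx => ?_⟩
    · obtain ⟨s, hs, hsx⟩ : ∃ s < t, x < K s :=
        (((ht.eventually (lt_mem_nhds hx)).filter_mono (nhdsWithin_le_nhds (s := Iio t))).and
          self_mem_nhdsWithin).exists.imp fun s h => ⟨h.2, h.1⟩
      obtain ⟨q, hq1, hq2⟩ := exists_rat_btwn hs
      filter_upwards [(hlq q).eventually (lt_mem_nhds (hsx.trans_le (hKle s q hq1)))] with n hn
      exact hn.trans_le (hk _ hq2.le)
    · obtain ⟨s, hs, hsx⟩ : ∃ s > t, K s < x :=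
        (((ht.eventually (gt_mem_nhds hx)).filter_mono (nhdsWithin_le_nhds (s := Ioi t))).and
          self_mem_nhdsWithin).exists.imp fun s h => ⟨h.2, h.1⟩
      obtain ⟨q, hq1, hq2⟩ := exists_rat_btwn hs
      filter_upwards [(hlq q).eventually (gt_mem_nhds ((hleK s q hq2.le).trans_lt hsx))] with n hn
      exact (hk _ hq1.le).trans_lt hn

/-! ### Carathéodory kernel convergence -/

section Kernel

variable {φ : ℕ → ℂ → ℂ} {F : ℂ → ℂ}

/-- A form of Hurwitz's theorem: the locally uniform limit of functions that omit the values `p n`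
omits the limit of the `p n`, unless it is constant. -/
theorem ne_of_tendstoLocallyUniformlyOn (hφ : ∀ n, DifferentiableOn ℂ (φ n) (ball 0 1))
    (hF : TendstoLocallyUniformlyOn φ F atTop (ball 0 1)) (hF0 : deriv F 0 ≠ 0)
    {p : ℕ → ℂ} {q : ℂ} (hp : Tendsto p atTop (𝓝 q)) (hpn : ∀ n, ∀ z ∈ ball (0 : ℂ) 1, φ n z ≠ p n)
    {z₀ : ℂ} (hz₀ : z₀ ∈ ball (0 : ℂ) 1) : F z₀ ≠ q := by
  intro hq
  have hFd : DifferentiableOn ℂ F (ball 0 1) :=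
    hF.differentiableOn (.of_forall hφ) isOpen_ball
  have hFa : AnalyticOnNhd ℂ F (ball 0 1) := hFd.analyticOnNhd isOpen_ball
  have hne : ∀ᶠ z in 𝓝[≠] z₀, F z - q ≠ 0 := by
    rcases ((hFa z₀ hz₀).sub analyticAt_const (g := fun _ => q)
      ).eventually_eq_zero_or_eventually_ne_zero with h | h
    · exfalso
      have heq : EqOn F (fun _ => q) (ball 0 1) :=
        hFa.eqOn_of_preconnected_of_eventuallyEq analyticOnNhd_const
          (convex_ball (0 : ℂ) 1).isPreconnected hz₀ (h.mono fun z hz => sub_eq_zero.1 hz)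
      apply hF0
      have : F =ᶠ[𝓝 0] fun _ => q := heq.eventuallyEq_of_mem (ball_mem_nhds _ one_pos)
      rw [this.deriv_eq, deriv_const]
    · exact h
  obtain ⟨ρ, hρ, hball⟩ := Metric.eventually_nhds_iff_ball.1
    ((eventually_nhdsWithin_iff.1 hne).and (isOpen_ball.mem_nhds hz₀))
  have hρ2 : 0 < ρ / 2 := half_pos hρ
  have hsub : closedBall z₀ (ρ / 2) ⊆ ball z₀ ρ := closedBall_subset_ball (half_lt_self hρ)
  have hsub1 : closedBall z₀ (ρ / 2) ⊆ ball 0 1 := fun z hz => (hball z (hsub hz)).2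
  have hsph : ∀ z ∈ sphere z₀ (ρ / 2), 0 < ‖F z - q‖ := fun z hz => by
    refine norm_pos_iff.2 ((hball z (hsub (sphere_subset_closedBall hz))).1 ?_)
    rintro rfl
    rw [mem_sphere, dist_self] at hz
    exact hρ2.ne hz
  obtain ⟨m, hm, hmin⟩ := (isCompact_sphere z₀ (ρ / 2)).exists_forall_le'
    (((hFd.continuousOn.mono (sphere_subset_closedBall.trans hsub1)).sub
      continuousOn_const).norm) hsph
  have hunif := (tendstoLocallyUniformlyOn_iff_forall_isCompact isOpen_ball).1 hF _
    (sphere_subset_closedBall.trans hsub1) (isCompact_sphere z₀ (ρ / 2))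
  -- Since `φ n - p n` has no zeros, the maximum principle for its reciprocal carries the lower
  -- bound from the circle around `z₀` to `z₀` itself.
  have hlow : ∀ᶠ n in atTop, m / 2 ≤ ‖φ n z₀ - p n‖ := by
    filter_upwards [Metric.tendstoUniformlyOn_iff.1 hunif (m / 4) (by positivity),
      Metric.tendsto_nhds.1 hp (m / 4) (by positivity)] with n hn1 hn2
    have hne' : ∀ z ∈ closedBall z₀ (ρ / 2), φ n z - p n ≠ 0 := fun z hz =>
      sub_ne_zero.2 (hpn n z (hsub1 hz))
    have hdc : DiffContOnCl ℂ (fun z => (φ n z - p n)⁻¹) (ball z₀ (ρ / 2)) := by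
      have : DifferentiableOn ℂ (fun z => (φ n z - p n)⁻¹) (closedBall z₀ (ρ / 2)) :=
        (((hφ n).mono hsub1).sub_const _).inv hne'
      exact this.diffContOnCl_ball subset_rfl
    have hb : ‖(φ n z₀ - p n)⁻¹‖ ≤ (m / 2)⁻¹ := by
      refine Complex.norm_le_of_forall_mem_frontier_norm_le isBounded_ball hdc (fun z hz => ?_)
        (subset_closure (mem_ball_self hρ2))
      rw [frontier_ball _ hρ2.ne'] at hz
      rw [norm_inv]
      refine inv_anti₀ (by positivity) ?_
      have h1 : m ≤ ‖F z - q‖ := hmin z hz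
      have h2 := hn1 z hz
      have h3 : ‖F z - q‖ ≤ dist (F z) (φ n z) + ‖φ n z - p n‖ + dist (p n) q := by
        rw [dist_eq_norm, dist_eq_norm]
        calc ‖F z - q‖ = ‖(F z - φ n z) + (φ n z - p n) + (p n - q)‖ := by ring_nf
          _ ≤ _ := norm_add₃_le
      linarith
    rw [norm_inv] at hb
    exact (inv_le_inv₀ (norm_pos_iff.2 (hne' z₀ (mem_closedBall_self hρ2.le)))
      (by positivity)).1 hb
  have hlim : Tendsto (fun n => ‖φ n z₀ - p n‖) atTop (𝓝 ‖F z₀ - q‖) :=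
    ((hF.tendsto_at hz₀).sub hp).norm
  have := ge_of_tendsto hlim hlow
  rw [hq, sub_self, norm_zero] at this
  linarith

theorem deriv_eq_mul_of_comp_eq {f g h : ℂ → ℂ} (hf : DifferentiableAt ℂ f 0)
    (hg : DifferentiableAt ℂ g 0) (hg0 : g 0 = 0) (h' : ∀ᶠ z in 𝓝 0, f (g z) = h z) :
    deriv f 0 * deriv g 0 = deriv h 0 := by
  have : h =ᶠ[𝓝 0] f ∘ g := h'.mono fun z hz => hz.symm
  rw [this.deriv_eq, deriv_comp _ (by rwa [hg0]) hg, hg0]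

variable {D : ℕ → Set ℂ} {D' : Set ℂ} {φ' : ℂ → ℂ}

/-- Schwarz's lemma for `φ₁⁻¹ ∘ φ'`, which maps the disc of radius `r` into the unit disc. -/
theorem mul_norm_deriv_le {D₁ : Set ℂ} {φ₁ : ℂ → ℂ} (h₁ : IsRiemannMap D₁ φ₁)
    (h' : IsRiemannMap D' φ') {r : ℝ} (hr : r ∈ Ioo (0 : ℝ) 1)
    (hsub : φ' '' closedBall 0 r ⊆ D₁) : r * ‖deriv φ' 0‖ ≤ ‖deriv φ₁ 0‖ := by
  obtain ⟨ψ, hψ, hleft⟩ := exists_holomorphic_inverse h₁.differentiableOn h₁.bijOn.injOn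
  rw [h₁.image_eq] at hψ
  have hψD : ∀ w ∈ D₁, ψ w ∈ ball (0 : ℂ) 1 ∧ φ₁ (ψ w) = w := fun w hw => by
    obtain ⟨z, hz, rfl⟩ := h₁.bijOn.surjOn hw
    rw [hleft z hz]
    exact ⟨hz, rfl⟩
  have hb : ball (0 : ℂ) r ⊆ ball 0 1 := ball_subset_ball hr.2.le
  have hm : ∀ z ∈ ball (0 : ℂ) r, φ' z ∈ D₁ := fun z hz =>
    hsub ⟨z, ball_subset_closedBall hz, rfl⟩
  set f : ℂ → ℂ := fun z => ψ (φ' z) with hf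
  have hfd : DifferentiableOn ℂ f (ball 0 r) := hψ.comp (h'.differentiableOn.mono hb) hm
  have hf0 : f 0 = 0 := by
    have := hleft 0 (by simp)
    rw [h₁.map_zero] at this
    rw [hf]
    simp only [h'.map_zero, this]
  have hS : ‖deriv f 0‖ ≤ 1 / r := by
    refine Complex.norm_deriv_le_div_of_mapsTo_ball hfd (fun z hz => ?_) hr.1
    rw [hf0]
    exact ball_subset_closedBall (hψD _ (hm z hz)).1
  have hchain := deriv_eq_mul_of_comp_eq (f := φ₁) (g := f) (h := φ')
    (h₁.differentiableOn.differentiableAt (ball_mem_nhds _ one_pos))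
    (hfd.differentiableAt (ball_mem_nhds _ hr.1)) hf0 (by
      filter_upwards [ball_mem_nhds (0 : ℂ) hr.1] with z hz using (hψD _ (hm z hz)).2)
  rw [← hchain, norm_mul]
  have hr0 := hr.1
  calc r * (‖deriv φ₁ 0‖ * ‖deriv f 0‖) ≤ r * (‖deriv φ₁ 0‖ * (1 / r)) := by gcongr
    _ = ‖deriv φ₁ 0‖ := by field_simp

/-- Uniqueness in the Carathéodory kernel theorem. -/
theorem eqOn_of_kernel (h : ∀ n, IsRiemannMap (D n) (φ n)) (hD' : IsOpen D')
    (h' : IsRiemannMap D' φ') (hF : TendstoLocallyUniformlyOn φ F atTop (ball 0 1))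
    (hin : ∀ r ∈ Ioo (0 : ℝ) 1, ∀ᶠ n in atTop, φ' '' closedBall 0 r ⊆ D n)
    (hout : ∀ q ∈ frontier D', ∃ p : ℕ → ℂ, Tendsto p atTop (𝓝 q) ∧ ∀ n, p n ∉ D n) :
    EqOn F φ' (ball 0 1) := by
  have h0 : (0 : ℂ) ∈ ball (0 : ℂ) 1 := by simp
  have hφ : ∀ n, DifferentiableOn ℂ (φ n) (ball 0 1) := fun n => (h n).differentiableOn
  have hFd : DifferentiableOn ℂ F (ball 0 1) := hF.differentiableOn (.of_forall hφ) isOpen_ball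
  have hF0 : F 0 = 0 := by
    refine tendsto_nhds_unique (hF.tendsto_at h0) ?_
    simp [(h _).map_zero]
  have hder : Tendsto (fun n => deriv (φ n) 0) atTop (𝓝 (deriv F 0)) :=
    (hF.deriv (.of_forall hφ) isOpen_ball).tendsto_at h0
  obtain ⟨ρ, hρ, hρ'⟩ := h'.deriv_pos
  have hlow : ρ ≤ ‖deriv F 0‖ := by
    have key : ∀ r ∈ Ioo (0 : ℝ) 1, r * ρ ≤ ‖deriv F 0‖ := fun r hr => by
      refine ge_of_tendsto hder.norm ?_
      filter_upwards [hin r hr] with n hn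
      have := mul_norm_deriv_le (h n) h' hr hn
      rwa [hρ', Complex.norm_real, Real.norm_of_nonneg hρ.le] at this
    have hlim : Tendsto (fun r : ℝ => r * ρ) (𝓝[<] 1) (𝓝 (1 * ρ)) :=
      ((continuous_id.mul continuous_const).tendsto 1).mono_left nhdsWithin_le_nhds
    rw [one_mul] at hlim
    refine le_of_tendsto hlim ?_
    filter_upwards [Ioo_mem_nhdsLT (zero_lt_one' ℝ)] with r hr using key r hr
  have hFne : deriv F 0 ≠ 0 := norm_pos_iff.1 (hρ.trans_le hlow)
  have hFreal : deriv F 0 = (‖deriv F 0‖ : ℂ) := by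
    refine tendsto_nhds_unique hder ?_
    have : Tendsto (fun n => ((‖deriv (φ n) 0‖ : ℝ) : ℂ)) atTop (𝓝 ((‖deriv F 0‖ : ℝ) : ℂ)) :=
      (Complex.continuous_ofReal.tendsto _).comp hder.norm
    refine this.congr fun n => ?_
    obtain ⟨s, hs, hs'⟩ := (h n).deriv_pos
    rw [hs', Complex.norm_real, Real.norm_of_nonneg hs.le]
  -- By Hurwitz `F` omits every frontier point of `D'`; its image is connected and contains `0`.
  have hFD : F '' ball 0 1 ⊆ D' := by
    refine subset_of_disjoint_frontier
      ((convex_ball (0 : ℂ) 1).isPreconnected.image _ hFd.continuousOn) hD' ?_ ?_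
    · refine ⟨0, ⟨0, h0, hF0⟩, ?_⟩
      rw [← h'.map_zero]
      exact h'.bijOn.mapsTo h0
    · rw [disjoint_left]
      rintro _ ⟨z, hz, rfl⟩ hfr
      obtain ⟨p, hp, hpn⟩ := hout _ hfr
      exact ne_of_tendstoLocallyUniformlyOn hφ hF hFne hp
        (fun n z hz e => hpn n (e ▸ (h n).bijOn.mapsTo hz)) hz rfl
  obtain ⟨ψ, hψ, hleft⟩ := exists_holomorphic_inverse h'.differentiableOn h'.bijOn.injOn
  rw [h'.image_eq] at hψ
  have hψD : ∀ w ∈ D', ψ w ∈ ball (0 : ℂ) 1 ∧ φ' (ψ w) = w := fun w hw => by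
    obtain ⟨z, hz, rfl⟩ := h'.bijOn.surjOn hw
    rw [hleft z hz]
    exact ⟨hz, rfl⟩
  have hm : ∀ z ∈ ball (0 : ℂ) 1, F z ∈ D' := fun z hz => hFD ⟨z, hz, rfl⟩
  set G : ℂ → ℂ := fun z => ψ (F z) with hG
  have hGd : DifferentiableOn ℂ G (ball 0 1) := hψ.comp hFd hm
  have hG0 : G 0 = 0 := by
    have := hleft 0 h0
    rw [h'.map_zero] at this
    rw [hG]
    simp only [hF0, this]
  have hGmaps : MapsTo G (ball 0 1) (closedBall (G 0) 1) := fun z hz => by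
    rw [hG0]
    exact ball_subset_closedBall (hψD _ (hm z hz)).1
  have hchain := deriv_eq_mul_of_comp_eq (f := φ') (g := G) (h := F)
    (h'.differentiableOn.differentiableAt (ball_mem_nhds _ one_pos))
    (hGd.differentiableAt (ball_mem_nhds _ one_pos)) hG0 (by
      filter_upwards [ball_mem_nhds (0 : ℂ) one_pos] with z hz using (hψD _ (hm z hz)).2)
  have hρne : (ρ : ℂ) ≠ 0 := by exact_mod_cast hρ.ne'
  have hG1 : deriv G 0 = ((‖deriv F 0‖ / ρ : ℝ) : ℂ) := by
    rw [hρ', hFreal] at hchain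
    push_cast
    field_simp
    linear_combination hchain
  have hnorm : ‖deriv G 0‖ = 1 := by
    refine le_antisymm (Complex.norm_deriv_le_one_of_mapsTo_ball hGd hGmaps one_pos) ?_
    rw [hG1, Complex.norm_real, Real.norm_of_nonneg (by positivity)]
    exact (one_le_div hρ).2 hlow
  have hGone : deriv G 0 = 1 := by
    rw [hG1, Complex.norm_real, Real.norm_of_nonneg (by positivity)] at hnorm
    rw [hG1, hnorm, Complex.ofReal_one]
  -- Equality in Schwarz's lemma makes `G` a rotation, and the positivity of the derivatives makes
  -- it the identity.
  have haff := Complex.affine_of_mapsTo_ball_of_norm_dslope_eq_div hGd hGmaps h0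
    (by rw [dslope_same, hnorm, div_one])
  intro z hz
  have hGz := haff hz
  rw [hG0, dslope_same, hGone] at hGz
  simp only [sub_zero, smul_eq_mul, mul_one, zero_add] at hGz
  have := (hψD _ (hm z hz)).2
  rw [show ψ (F z) = z from hGz] at this
  exact this.symm

end Kernel

/-! ### Reparametrization of the boundary curves -/

/-- Up to affine rescaling, `m` is the inverse of one reparametrization followed by the other. Its
constant extension outside the interval makes it possible to concatenate several such maps by
addition. -/
theorem exists_monotone_reparam {P Q : ℝ → ℂ} {x₀ x₁ y₀ y₁ : ℝ} (hx : x₀ < x₁) (hy : y₀ < y₁)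
    {ε : ℝ}
    (h : curveDist (fun t : unitInterval => P ((1 - (t : ℝ)) * x₀ + (t : ℝ) * x₁))
      (fun t : unitInterval => Q ((1 - (t : ℝ)) * y₀ + (t : ℝ) * y₁)) < ENNReal.ofReal ε) :
    ∃ m : ℝ → ℝ, Monotone m ∧ (∀ t ≤ x₀, m t = y₀) ∧ (∀ t, x₁ ≤ t → m t = y₁) ∧
      (∀ t ∈ Icc x₀ x₁, dist (P t) (Q (m t)) ≤ ε) ∧
      ∀ s ∈ Icc y₀ y₁, ∃ t ∈ Icc x₀ x₁, m t = s := by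
  unfold curveDist at h
  simp only [iInf_lt_iff] at h
  obtain ⟨f, g, hfg⟩ := h
  have hε : 0 ≤ ε := by
    by_contra hneg
    rw [ENNReal.ofReal_of_nonpos (not_le.1 hneg).le] at hfg
    exact not_lt_bot hfg
  have hx' : 0 < x₁ - x₀ := sub_pos.2 hx
  have hy' : 0 < y₁ - y₀ := sub_pos.2 hy
  set e : unitInterval ≃o unitInterval := f.symm.trans g with he
  set u : ℝ → unitInterval := fun t => projIcc 0 1 zero_le_one ((t - x₀) / (x₁ - x₀)) with hu
  have hu_mono : Monotone u := fun s t hst =>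
    monotone_projIcc _ (div_le_div_of_nonneg_right (sub_le_sub_right hst _) hx'.le)
  refine ⟨fun t => y₀ + (y₁ - y₀) * (e (u t) : ℝ), fun s t hst => ?_, fun t ht => ?_,
    fun t ht => ?_, fun t ht => ?_, fun s hs => ?_⟩
  · have : (e (u s) : ℝ) ≤ e (u t) := e.monotone (hu_mono hst)
    simp only
    gcongr
  · have : u t = ⊥ := projIcc_of_le_left _ (div_nonpos_of_nonpos_of_nonneg (by linarith) hx'.le)
    simp only [this, OrderIso.map_bot]
    change y₀ + (y₁ - y₀) * (0 : ℝ) = y₀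
    ring
  · have : u t = ⊤ := projIcc_of_right_le _ ((one_le_div hx').2 (by linarith))
    simp only [this, OrderIso.map_top]
    change y₀ + (y₁ - y₀) * (1 : ℝ) = y₁
    ring
  · have hut : (u t : ℝ) = (t - x₀) / (x₁ - x₀) := by
      have : (t - x₀) / (x₁ - x₀) ∈ Icc (0 : ℝ) 1 :=
        ⟨div_nonneg (by linarith [ht.1]) hx'.le, (div_le_one hx').2 (by linarith [ht.2])⟩
      rw [hu]; simp only [projIcc_of_mem _ this]
    have h1 := (le_iSup (fun t : unitInterval => edist (P ((1 - (f t : ℝ)) * x₀ + (f t : ℝ) * x₁))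
      (Q ((1 - (g t : ℝ)) * y₀ + (g t : ℝ) * y₁))) (f.symm (u t))).trans hfg.le
    simp only [OrderIso.apply_symm_apply] at h1
    rw [edist_dist, ENNReal.ofReal_le_ofReal_iff hε] at h1
    have e1 : (1 - (u t : ℝ)) * x₀ + (u t : ℝ) * x₁ = t := by
      rw [hut]; field_simp; ring
    have e2 : (1 - (g (f.symm (u t)) : ℝ)) * y₀ + (g (f.symm (u t)) : ℝ) * y₁ =
        y₀ + (y₁ - y₀) * (e (u t) : ℝ) := by
      simp only [he, OrderIso.trans_apply]; ring
    rwa [e1, e2] at h1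
  · have hs' : (s - y₀) / (y₁ - y₀) ∈ Icc (0 : ℝ) 1 :=
      ⟨div_nonneg (by linarith [hs.1]) hy'.le, (div_le_one hy').2 (by linarith [hs.2])⟩
    set v : unitInterval := e.symm ⟨_, hs'⟩ with hv
    refine ⟨x₀ + (x₁ - x₀) * (v : ℝ), ⟨?_, ?_⟩, ?_⟩
    · nlinarith [v.2.1]
    · nlinarith [v.2.2]
    · have : u (x₀ + (x₁ - x₀) * (v : ℝ)) = v := by
        rw [hu]
        simp only
        rw [add_sub_cancel_left, mul_div_cancel_left₀ _ hx'.ne', projIcc_val]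
      simp only [this]
      rw [hv, OrderIso.apply_symm_apply]
      field_simp
      ring

/-- A monotone correspondence `k` between the parameter intervals `[c, c + 2π]` and `[c', c' + 2π]`
of two closed curves `P` and `Q` that are `ε`-close under it; it maps the subdivision
`c < d < a < c + 2π` to the subdivision `c' < d' < a' < c' + 2π`. -/
structure IsMatching (P Q : ℝ → ℂ) (c d a c' d' a' ε : ℝ) (k : ℝ → ℝ) : Prop where
  mono : Monotone k
  mem_Icc : ∀ t, k t ∈ Icc c' (c' + 2 * Real.pi)
  le_d : ∀ t ≤ d, k t ≤ d'
  ge_d : ∀ t, d ≤ t → d' ≤ k t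
  le_a : ∀ t ≤ a, k t ≤ a'
  ge_a : ∀ t, a ≤ t → a' ≤ k t
  dist_le : ∀ t ∈ Icc c (c + 2 * Real.pi), dist (P t) (Q (k t)) ≤ ε
  surj : ∀ s ∈ Icc c' (c' + 2 * Real.pi), ∃ t ∈ Icc c (c + 2 * Real.pi), k t = s

theorem boundaryArc_add_int_mul (φ : ℂ → ℂ) (x y : ℝ) (m : ℤ) :
    boundaryArc φ (x + m * (2 * Real.pi)) (y + m * (2 * Real.pi)) = boundaryArc φ x y := by
  funext t
  simp only [boundaryArc]
  rw [← boundaryPt_add_int_mul φ ((1 - (t : ℝ)) * x + (t : ℝ) * y) m]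
  congr 1
  ring

theorem exists_isMatching {φ φ' : ℂ → ℂ} {α γ δ α' γ' δ' ε : ℝ}
    (h₁ : α < γ) (h₂ : γ < δ) (h₃ : δ < α + 2 * Real.pi)
    (h₁' : α' < γ') (h₂' : γ' < δ') (h₃' : δ' < α' + 2 * Real.pi)
    (hda : curveDist (boundaryArc φ δ (α + 2 * Real.pi)) (boundaryArc φ' δ' (α' + 2 * Real.pi)) <
      ENNReal.ofReal ε)
    (hac : curveDist (boundaryArc φ α γ) (boundaryArc φ' α' γ') < ENNReal.ofReal ε)
    (hcd : curveDist (boundaryArc φ γ δ) (boundaryArc φ' γ' δ') < ENNReal.ofReal ε) :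
    ∃ k, IsMatching (boundaryPt φ) (boundaryPt φ') γ δ (α + 2 * Real.pi) γ' δ' (α' + 2 * Real.pi)
      ε k := by
  have hac' : curveDist (boundaryArc φ (α + 2 * Real.pi) (γ + 2 * Real.pi))
      (boundaryArc φ' (α' + 2 * Real.pi) (γ' + 2 * Real.pi)) < ENNReal.ofReal ε := by
    have e := boundaryArc_add_int_mul φ α γ 1
    have e' := boundaryArc_add_int_mul φ' α' γ' 1
    simp only [Int.cast_one, one_mul] at e e'
    rwa [e, e']
  obtain ⟨m₁, mono₁, l₁, r₁, d₁, s₁⟩ := exists_monotone_reparam h₂ h₂' hcd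
  obtain ⟨m₂, mono₂, l₂, r₂, d₂, s₂⟩ := exists_monotone_reparam h₃ h₃' hda
  obtain ⟨m₃, mono₃, l₃, r₃, d₃, s₃⟩ := exists_monotone_reparam
    (add_lt_add_left h₁ (2 * Real.pi)) (add_lt_add_left h₁' (2 * Real.pi)) hac'
  have lo₁ : ∀ t, γ' ≤ m₁ t := fun t => (l₁ _ (min_le_right t γ)).symm.le.trans
    (mono₁ (min_le_left t γ))
  have lo₂ : ∀ t, δ' ≤ m₂ t := fun t => (l₂ _ (min_le_right t δ)).symm.le.trans
    (mono₂ (min_le_left t δ))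
  have lo₃ : ∀ t, α' + 2 * Real.pi ≤ m₃ t := fun t => (l₃ _ (min_le_right t _)).symm.le.trans
    (mono₃ (min_le_left t _))
  have hi₁ : ∀ t, m₁ t ≤ δ' := fun t => (mono₁ (le_max_left t δ)).trans
    (r₁ _ (le_max_right t δ)).le
  have hi₂ : ∀ t, m₂ t ≤ α' + 2 * Real.pi := fun t => (mono₂ (le_max_left t _)).trans
    (r₂ _ (le_max_right t _)).le
  have hi₃ : ∀ t, m₃ t ≤ γ' + 2 * Real.pi := fun t => (mono₃ (le_max_left t _)).trans
    (r₃ _ (le_max_right t _)).le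
  -- Each summand moves only on its own arc, so the sum is the concatenation along `cd`, `da` and
  -- the arc `ac` shifted by `2π`.
  set k : ℝ → ℝ := fun t => m₁ t + (m₂ t - δ') + (m₃ t - (α' + 2 * Real.pi)) with hk
  have k₁ : ∀ t ≤ δ, k t = m₁ t := fun t ht => by
    simp only [hk, l₂ t ht, l₃ t (ht.trans h₃.le)]; ring
  have k₂ : ∀ t, δ ≤ t → t ≤ α + 2 * Real.pi → k t = m₂ t := fun t ht ht' => by
    simp only [hk, r₁ t ht, l₃ t ht']; ring
  have k₃ : ∀ t, α + 2 * Real.pi ≤ t → k t = m₃ t := fun t ht => by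
    simp only [hk, r₁ t (h₃.le.trans ht), r₂ t ht]; ring
  refine ⟨k, fun s t hst => ?_, fun t => ⟨?_, ?_⟩, fun t ht => ?_, fun t ht => ?_, fun t ht => ?_,
    fun t ht => ?_, fun t ht => ?_, fun s hs => ?_⟩
  · have := mono₁ hst
    have := mono₂ hst
    have := mono₃ hst
    simp only [hk]
    linarith
  · simp only [hk]; linarith [lo₁ t, lo₂ t, lo₃ t]
  · simp only [hk]; linarith [hi₁ t, hi₂ t, hi₃ t]
  · rw [k₁ t ht]; exact hi₁ t
  · simp only [hk, r₁ t ht]; linarith [lo₂ t, lo₃ t]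
  · simp only [hk, l₃ t ht]; linarith [hi₁ t, hi₂ t]
  · rw [k₃ t ht]; exact lo₃ t
  · rcases le_total t δ with h | h
    · rw [k₁ t h]; exact d₁ t ⟨ht.1, h⟩
    · rcases le_total t (α + 2 * Real.pi) with h' | h'
      · rw [k₂ t h h']; exact d₂ t ⟨h, h'⟩
      · rw [k₃ t h']; exact d₃ t ⟨h', ht.2⟩
  · rcases le_total s δ' with h | h
    · obtain ⟨t, ht, hts⟩ := s₁ s ⟨hs.1, h⟩
      exact ⟨t, ⟨ht.1, by linarith [ht.2]⟩, by rw [k₁ t ht.2, hts]⟩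
    · rcases le_total s (α' + 2 * Real.pi) with h' | h'
      · obtain ⟨t, ht, hts⟩ := s₂ s ⟨h, h'⟩
        exact ⟨t, ⟨by linarith [ht.1], by linarith [ht.2]⟩, by rw [k₂ t ht.1 ht.2, hts]⟩
      · obtain ⟨t, ht, hts⟩ := s₃ s ⟨h', hs.2⟩
        exact ⟨t, ⟨by linarith [ht.1], ht.2⟩, by rw [k₃ t ht.1, hts]⟩

/-! ### Convergence of the Riemann maps -/

/-- A sequence of domains whose boundary curves are matched with the boundary curve of `D'`, with
errors `ε n` that tend to `0`, by monotone functions `k n` that converge to `K`. -/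
structure ConvergentMatching (D : ℕ → Set ℂ) (φ : ℕ → ℂ → ℂ) (c d a : ℕ → ℝ) (D' : Set ℂ)
    (φ' : ℂ → ℂ) (c' d' a' : ℝ) (ε : ℕ → ℝ) (k : ℕ → ℝ → ℝ) (C : ℝ) (K : ℝ → ℝ) : Prop where
  dom : ∀ n, IsCurveDomain (D n)
  map : ∀ n, IsRiemannMap (D n) (φ n)
  dom' : IsCurveDomain D'
  map' : IsRiemannMap D' φ'
  matching : ∀ n, IsMatching (boundaryPt (φ n)) (boundaryPt φ') (c n) (d n) (a n) c' d' a' (ε n) (k n)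
  tendsto_eps : Tendsto ε atTop (𝓝 0)
  tendsto_c : Tendsto c atTop (𝓝 C)
  mono : Monotone K
  tendsto_k : ∀ t, ContinuousAt K t → Tendsto (fun n => k n t) atTop (𝓝 (K t))

theorem IsMatching.exists_dist_le {φ : ℂ → ℂ} {Q : ℝ → ℂ} {c d a c' d' a' ε : ℝ} {k : ℝ → ℝ}
    (h : IsMatching (boundaryPt φ) Q c d a c' d' a' ε k) (t : ℝ) :
    ∃ s, dist (boundaryPt φ t) (Q s) ≤ ε := by
  obtain ⟨m, hm, -⟩ := existsUnique_add_zsmul_mem_Ico Real.two_pi_pos t c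
  rw [zsmul_eq_mul] at hm
  refine ⟨k (t + m * (2 * Real.pi)), ?_⟩
  rw [← boundaryPt_add_int_mul φ t m]
  exact h.dist_le _ ⟨hm.1, hm.2.le⟩

theorem IsCurveDomain.isBounded_frontier {D : Set ℂ} (hD : IsCurveDomain D) :
    Bornology.IsBounded (frontier D) :=
  hD.isBounded.closure.subset frontier_subset_closure

theorem diffContOnCl_extendFrom {D : Set ℂ} {φ : ℂ → ℂ} (hD : IsCurveDomain D)
    (hφ : IsRiemannMap D φ) : DiffContOnCl ℂ (extendFrom (ball 0 1) φ) (ball 0 1) := by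
  refine ⟨hφ.differentiableOn.congr fun z hz => extendFrom_eq_of_mem_ball hφ hz, ?_⟩
  rw [closure_ball _ one_ne_zero]
  exact continuousOn_extendFrom_closedBall hD hφ

theorem exists_circlePt_eq {w : ℂ} (hw : ‖w‖ = 1) : ∃ θ, circlePt θ = w :=
  ⟨w.arg, by simpa [hw, circlePt] using Complex.norm_mul_exp_arg_mul_I w⟩

/-- The maximum principle for Riemann maps. -/
theorem norm_le_of_norm_boundaryPt_le {D : Set ℂ} {φ : ℂ → ℂ} (hD : IsCurveDomain D)
    (hφ : IsRiemannMap D φ) {M : ℝ} (hM : ∀ t, ‖boundaryPt φ t‖ ≤ M) {z : ℂ}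
    (hz : z ∈ ball (0 : ℂ) 1) : ‖φ z‖ ≤ M := by
  rw [← extendFrom_eq_of_mem_ball hφ hz]
  refine Complex.norm_le_of_forall_mem_frontier_norm_le isBounded_ball
    (diffContOnCl_extendFrom hD hφ) (fun w hw => ?_) (subset_closure hz)
  rw [frontier_ball _ one_ne_zero, mem_sphere_zero_iff_norm] at hw
  obtain ⟨θ, rfl⟩ := exists_circlePt_eq hw
  exact hM θ

/-- Cauchy's integral formula in terms of the boundary curve. -/
theorem eq_integral_boundaryPt {D : Set ℂ} {φ : ℂ → ℂ} (hD : IsCurveDomain D)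
    (hφ : IsRiemannMap D φ) {z : ℂ} (hz : z ∈ ball (0 : ℂ) 1) (C : ℝ) :
    φ z = (2 * Real.pi : ℂ)⁻¹ * ∫ t in C..C + 2 * Real.pi,
      boundaryPt φ t * (circlePt t / (circlePt t - z)) := by
  have h := (diffContOnCl_extendFrom hD hφ).two_pi_i_inv_smul_circleIntegral_sub_inv_smul hz
  rw [extendFrom_eq_of_mem_ball hφ hz] at h
  have hper : Function.Periodic
      (fun t => boundaryPt φ t * (circlePt t / (circlePt t - z))) (2 * Real.pi) := fun t => by
    have e := circlePt_add_int_mul t 1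
    rw [Int.cast_one, one_mul] at e
    simp only [boundaryPt_add_two_pi, e]
  rw [hper.intervalIntegral_add_eq C 0, zero_add, ← h, circleIntegral]
  have hcm : ∀ t : ℝ, circleMap 0 1 t = circlePt t := fun t => by simp [circleMap, circlePt]
  have e2 : ∀ t : ℝ, deriv (circleMap 0 1) t • ((circleMap 0 1 t - z)⁻¹ •
      extendFrom (ball 0 1) φ (circleMap 0 1 t)) =
      Complex.I * (boundaryPt φ t * (circlePt t / (circlePt t - z))) := fun t => by
    rw [deriv_circleMap, hcm, smul_eq_mul, smul_eq_mul, boundaryPt]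
    ring
  rw [intervalIntegral.integral_congr fun t _ => e2 t, intervalIntegral.integral_const_mul,
    smul_eq_mul]
  have := Complex.I_ne_zero
  have hpi : (Real.pi : ℂ) ≠ 0 := by exact_mod_cast Real.pi_ne_zero
  field_simp

namespace ConvergentMatching

variable {D : ℕ → Set ℂ} {φ : ℕ → ℂ → ℂ} {c d a : ℕ → ℝ} {D' : Set ℂ} {φ' : ℂ → ℂ}
  {c' d' a' : ℝ} {ε : ℕ → ℝ} {k : ℕ → ℝ → ℝ} {C : ℝ} {K : ℝ → ℝ}

theorem exists_bound (h : ConvergentMatching D φ c d a D' φ' c' d' a' ε k C K) :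
    ∃ M, 0 < M ∧ (∀ n t, ‖boundaryPt (φ n) t‖ ≤ M) ∧ ∀ t, ‖boundaryPt φ' t‖ ≤ M := by
  obtain ⟨R, hR⟩ := h.dom'.isBounded_frontier.exists_norm_le
  obtain ⟨B, hB⟩ := h.tendsto_eps.bddAbove_range
  have hR' : ∀ t, ‖boundaryPt φ' t‖ ≤ R := fun t => hR _ (boundaryPt_mem_frontier h.dom' h.map' t)
  have hR0 : 0 ≤ R := (norm_nonneg _).trans (hR' 0)
  refine ⟨R + |B| + 1, by positivity, fun n t => ?_, fun t => ?_⟩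
  · obtain ⟨s, hs⟩ := (h.matching n).exists_dist_le t
    have h1 : ε n ≤ B := hB ⟨n, rfl⟩
    have h2 := norm_le_norm_add_norm_sub' (boundaryPt (φ n) t) (boundaryPt φ' s)
    rw [← dist_eq_norm] at h2
    linarith [hR' s, le_abs_self B]
  · linarith [hR' t, abs_nonneg B]

/-- The image is a compact part of `D'`, at positive distance from `∂D'`, hence eventually disjoint
from `∂D_n`; being connected and containing `0 ∈ D_n`, it lies in `D_n`. -/
theorem eventually_image_subset (h : ConvergentMatching D φ c d a D' φ' c' d' a' ε k C K) {r : ℝ}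
    (hr : r ∈ Ioo (0 : ℝ) 1) : ∀ᶠ n in atTop, φ' '' closedBall 0 r ⊆ D n := by
  have hb : closedBall (0 : ℂ) r ⊆ ball 0 1 := closedBall_subset_ball hr.2
  have hcont : ContinuousOn φ' (closedBall 0 r) := h.map'.differentiableOn.continuousOn.mono hb
  have hLc : IsCompact (φ' '' closedBall 0 r) :=
    (isCompact_closedBall (0 : ℂ) r).image_of_continuousOn hcont
  have hLD : φ' '' closedBall 0 r ⊆ D' := by
    rintro _ ⟨z, hz, rfl⟩
    exact h.map'.bijOn.mapsTo (hb hz)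
  have hdisj : Disjoint (φ' '' closedBall 0 r) (frontier D') := by
    rw [h.dom'.isOpen.frontier_eq, disjoint_left]
    exact fun w hw hw' => hw'.2 (hLD hw)
  obtain ⟨η, hη, hsep⟩ := hLc.exists_thickening_subset_open isClosed_frontier.isOpen_compl
    hdisj.subset_compl_right
  filter_upwards [h.tendsto_eps.eventually (gt_mem_nhds hη)] with n hn
  refine subset_of_disjoint_frontier
    ((convex_closedBall (0 : ℂ) r).isPreconnected.image _ hcont) (h.dom n).isOpen ?_ ?_
  · exact ⟨0, ⟨0, by simp [hr.1.le], h.map'.map_zero⟩, (h.dom n).zero_mem⟩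
  · rw [disjoint_left]
    intro y hy hyD
    obtain ⟨t, rfl⟩ := exists_boundaryPt_eq (h.dom n) (h.map n) hyD
    obtain ⟨s, hs⟩ := (h.matching n).exists_dist_le t
    refine hsep ?_ (boundaryPt_mem_frontier h.dom' h.map' s)
    rw [Metric.mem_thickening_iff]
    exact ⟨_, hy, by rw [dist_comm]; exact hs.trans_lt hn⟩

/-- Surjectivity of the matchings makes every point of `∂D'` a limit of points of `∂D_n`. -/
theorem exists_tendsto_notMem (h : ConvergentMatching D φ c d a D' φ' c' d' a' ε k C K) {q : ℂ}
    (hq : q ∈ frontier D') : ∃ p : ℕ → ℂ, Tendsto p atTop (𝓝 q) ∧ ∀ n, p n ∉ D n := by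
  obtain ⟨θ, rfl⟩ := exists_boundaryPt_eq h.dom' h.map' hq
  obtain ⟨m, hm, -⟩ := existsUnique_add_zsmul_mem_Ico Real.two_pi_pos θ c'
  rw [zsmul_eq_mul] at hm
  choose t ht hts using fun n => (h.matching n).surj _ ⟨hm.1, hm.2.le⟩
  refine ⟨fun n => boundaryPt (φ n) (t n), ?_, fun n hn => ?_⟩
  · rw [tendsto_iff_dist_tendsto_zero]
    refine squeeze_zero (fun _ => dist_nonneg) (fun n => ?_) h.tendsto_eps
    have := (h.matching n).dist_le _ (ht n)
    rwa [hts n, boundaryPt_add_int_mul] at this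
  · have := boundaryPt_mem_frontier (h.dom n) (h.map n) (t n)
    rw [(h.dom n).isOpen.frontier_eq] at this
    exact this.2 hn

theorem tendsto_boundaryPt_of_continuousAt
    (h : ConvergentMatching D φ c d a D' φ' c' d' a' ε k C K) {t : ℝ}
    (ht : t ∈ Ioo C (C + 2 * Real.pi)) (hK : ContinuousAt K t) :
    Tendsto (fun n => boundaryPt (φ n) t) atTop (𝓝 (boundaryPt φ' (K t))) := by
  have h1 : Tendsto (fun n => boundaryPt φ' (k n t)) atTop (𝓝 (boundaryPt φ' (K t))) :=
    ((continuous_boundaryPt h.dom' h.map').tendsto _).comp (h.tendsto_k t hK)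
  refine (tendsto_iff_of_dist ?_).2 h1
  refine squeeze_zero' (.of_forall fun _ => dist_nonneg) ?_ h.tendsto_eps
  filter_upwards [h.tendsto_c.eventually (gt_mem_nhds ht.1),
    (h.tendsto_c.add_const (2 * Real.pi)).eventually (lt_mem_nhds ht.2)] with n h1 h2
  exact (h.matching n).dist_le t ⟨h1.le, h2.le⟩

open MeasureTheory in
-- A monotone function has only countably many discontinuities.
theorem ae_tendsto_boundaryPt (h : ConvergentMatching D φ c d a D' φ' c' d' a' ε k C K) :
    ∀ᵐ t, t ∈ Ioc C (C + 2 * Real.pi) →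
      Tendsto (fun n => boundaryPt (φ n) t) atTop (𝓝 (boundaryPt φ' (K t))) := by
  filter_upwards [h.mono.countable_not_continuousAt.ae_notMem volume,
    (countable_singleton (C + 2 * Real.pi)).ae_notMem volume] with t hc hne ht
  exact h.tendsto_boundaryPt_of_continuousAt ⟨ht.1, lt_of_le_of_ne ht.2 hne⟩ (not_not.1 hc)

theorem measurable_boundaryPt_comp (h : ConvergentMatching D φ c d a D' φ' c' d' a' ε k C K) :
    Measurable fun t => boundaryPt φ' (K t) :=
  (continuous_boundaryPt h.dom' h.map').measurable.comp h.mono.measurable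

open MeasureTheory in
theorem tendsto_integral_norm_sub (h : ConvergentMatching D φ c d a D' φ' c' d' a' ε k C K) :
    Tendsto (fun n => ∫ t in C..C + 2 * Real.pi, ‖boundaryPt (φ n) t - boundaryPt φ' (K t)‖) atTop
      (𝓝 0) := by
  obtain ⟨M, hM, hMn, hM'⟩ := h.exists_bound
  have : (∫ _ in C..C + 2 * Real.pi, (0 : ℝ)) = 0 := by simp
  rw [← this]
  refine intervalIntegral.tendsto_integral_filter_of_dominated_convergence (fun _ => M + M)
    (.of_forall fun n => ?_) (.of_forall fun n => .of_forall fun t _ => ?_)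
    intervalIntegrable_const ?_
  · exact ((continuous_boundaryPt (h.dom n) (h.map n)).measurable.sub
      h.measurable_boundaryPt_comp).norm.aestronglyMeasurable
  · rw [norm_norm]
    exact (norm_sub_le _ _).trans (add_le_add (hMn n t) (hM' _))
  · filter_upwards [h.ae_tendsto_boundaryPt] with t ht htm
    rw [uIoc_of_le (by linarith [Real.two_pi_pos])] at htm
    simpa using ((ht htm).sub_const (boundaryPt φ' (K t))).norm

open MeasureTheory in
-- The boundary values converge in `L¹`, and Cauchy's kernel is bounded on compact subsets of the
-- disc. The limit is the Cauchy integral of `boundaryPt φ' ∘ K`, not yet known to be `φ'`.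
theorem exists_tendstoLocallyUniformlyOn
    (h : ConvergentMatching D φ c d a D' φ' c' d' a' ε k C K) :
    ∃ F, TendstoLocallyUniformlyOn φ F atTop (ball 0 1) := by
  obtain ⟨M, hM, hMn, hM'⟩ := h.exists_bound
  have hpi := Real.two_pi_pos
  refine ⟨fun z => (2 * Real.pi : ℂ)⁻¹ * ∫ t in C..C + 2 * Real.pi,
      boundaryPt φ' (K t) * (circlePt t / (circlePt t - z)), ?_⟩
  rw [tendstoLocallyUniformlyOn_iff_forall_isCompact isOpen_ball]
  intro L hL hLc
  obtain ⟨r, hr, hLr⟩ : ∃ r < 1, L ⊆ closedBall 0 r := by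
    obtain ⟨r, hr, hLr⟩ := exists_lt_subset_ball hLc.isClosed hL
    exact ⟨r, hr, hLr.trans ball_subset_closedBall⟩
  have hr1 : 0 < 1 - r := sub_pos.2 hr
  rw [Metric.tendstoUniformlyOn_iff]
  intro η hη
  filter_upwards [h.tendsto_integral_norm_sub.eventually
    (gt_mem_nhds (show 0 < η * (1 - r) by positivity))] with n hn z hz
  have hz1 := hL hz
  have hzr : ‖z‖ ≤ r := mem_closedBall_zero_iff.1 (hLr hz)
  have hden : ∀ t, 1 - r ≤ ‖circlePt t - z‖ := fun t => by
    have := norm_sub_norm_le (circlePt t) z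
    rw [norm_circlePt] at this
    linarith
  have hker : Continuous fun t => circlePt t / (circlePt t - z) :=
    continuous_circlePt.div (continuous_circlePt.sub continuous_const) fun t =>
      norm_pos_iff.1 (hr1.trans_le (hden t))
  have hkb : ∀ t, ‖circlePt t / (circlePt t - z)‖ ≤ (1 - r)⁻¹ := fun t => by
    rw [norm_div, norm_circlePt, one_div]
    exact inv_anti₀ hr1 (hden t)
  have hbi : IntervalIntegrable (fun t => boundaryPt φ' (K t)) volume C (C + 2 * Real.pi) := by
    refine (intervalIntegrable_const (c := M)).mono_fun
      h.measurable_boundaryPt_comp.aestronglyMeasurable (.of_forall fun t => ?_)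
    simp only [Real.norm_of_nonneg hM.le]
    exact hM' _
  have hbn : IntervalIntegrable (fun t => boundaryPt (φ n) t) volume C (C + 2 * Real.pi) :=
    (continuous_boundaryPt (h.dom n) (h.map n)).intervalIntegrable _ _
  rw [eq_integral_boundaryPt (h.dom n) (h.map n) hz1 C, dist_comm, dist_eq_norm, ← mul_sub,
    ← intervalIntegral.integral_sub (hbn.mul_continuousOn hker.continuousOn)
      (hbi.mul_continuousOn hker.continuousOn), norm_mul]
  have hint : ‖∫ t in C..C + 2 * Real.pi, (boundaryPt (φ n) t * (circlePt t / (circlePt t - z)) -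
      boundaryPt φ' (K t) * (circlePt t / (circlePt t - z)))‖ ≤
      ∫ t in C..C + 2 * Real.pi, ‖boundaryPt (φ n) t - boundaryPt φ' (K t)‖ * (1 - r)⁻¹ := by
    refine intervalIntegral.norm_integral_le_of_norm_le (by linarith) (.of_forall fun t _ => ?_)
      ((hbn.sub hbi).norm.mul_const _)
    rw [← sub_mul, norm_mul]
    gcongr
    exact hkb t
  rw [intervalIntegral.integral_mul_const] at hint
  have h2pi : ‖(2 * Real.pi : ℂ)⁻¹‖ ≤ 1 := by
    rw [norm_inv, norm_mul, Complex.norm_real, Real.norm_of_nonneg Real.pi_pos.le]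
    refine inv_le_one_of_one_le₀ ?_
    norm_num
    linarith [Real.pi_gt_three]
  calc _ ≤ 1 * ((∫ t in C..C + 2 * Real.pi, ‖boundaryPt (φ n) t - boundaryPt φ' (K t)‖) *
        (1 - r)⁻¹) := by gcongr
    _ < 1 * (η * (1 - r) * (1 - r)⁻¹) := by gcongr
    _ = η := by field_simp

theorem tendstoLocallyUniformlyOn (h : ConvergentMatching D φ c d a D' φ' c' d' a' ε k C K) :
    TendstoLocallyUniformlyOn φ φ' atTop (ball 0 1) := by
  obtain ⟨F, hF⟩ := h.exists_tendstoLocallyUniformlyOn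
  exact hF.congr_right (eqOn_of_kernel h.map h.dom'.isOpen h.map' hF
    (fun r hr => h.eventually_image_subset hr) fun q hq => h.exists_tendsto_notMem hq)

end ConvergentMatching

/-! ### Integrals along the boundary -/

theorem mul_circlePt_mem_ball {r : ℝ} (hr : r ∈ Ico (0 : ℝ) 1) (t : ℝ) :
    (r : ℂ) * circlePt t ∈ ball (0 : ℂ) 1 := by
  rw [mem_ball_zero_iff, norm_mul, norm_circlePt, mul_one, Complex.norm_real,
    Real.norm_of_nonneg hr.1]
  exact hr.2

theorem hasDerivAt_mul_circlePt (r t : ℝ) :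
    HasDerivAt (fun t : ℝ => (r : ℂ) * circlePt t) (r * circlePt t * Complex.I) t := by
  have := ((Complex.ofRealCLM.hasDerivAt (x := t)).mul_const Complex.I).cexp.const_mul (r : ℂ)
  simpa [circlePt, mul_assoc] using! this

section Radial

variable {D : Set ℂ} {φ : ℂ → ℂ}

theorem continuous_comp_mul_circlePt (hφ : DifferentiableOn ℂ φ (ball 0 1)) {r : ℝ}
    (hr : r ∈ Ico (0 : ℝ) 1) : Continuous fun t => φ (r * circlePt t) :=
  hφ.continuousOn.comp_continuous (continuous_const.mul continuous_circlePt)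
    fun t => mul_circlePt_mem_ball hr t

/-- Each integral is a difference of values of a primitive of `φ`, and a radial move changes the
primitive by at most `M |r' - r|` at either end. The bound depends on `φ` only through `M`, hence is
uniform along the sequence. -/
theorem norm_integral_sub_integral_le (hφ : DifferentiableOn ℂ φ (ball 0 1)) {M : ℝ}
    (hM : ∀ z ∈ ball (0 : ℂ) 1, ‖φ z‖ ≤ M) {r r' : ℝ} (hr : r ∈ Ico (0 : ℝ) 1)
    (hr' : r' ∈ Ico (0 : ℝ) 1) (s t : ℝ) :
    ‖(∫ x in s..t, φ (r' * circlePt x) * (r' * circlePt x * Complex.I)) -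
      ∫ x in s..t, φ (r * circlePt x) * (r * circlePt x * Complex.I)‖ ≤ 2 * M * |r' - r| := by
  obtain ⟨g, hg⟩ := hφ.isExactOn_ball
  have key : ∀ u ∈ Ico (0 : ℝ) 1, ∫ x in s..t, φ (u * circlePt x) * (u * circlePt x * Complex.I) =
      g (u * circlePt t) - g (u * circlePt s) := fun u hu => by
    refine intervalIntegral.integral_eq_sub_of_hasDerivAt (f := fun x => g (u * circlePt x))
      (fun x _ => ?_) (Continuous.intervalIntegrable ?_ _ _)
    · exact (hg _ (mul_circlePt_mem_ball hu x)).comp x (hasDerivAt_mul_circlePt u x)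
    · exact (continuous_comp_mul_circlePt hφ hu).mul
        ((continuous_const.mul continuous_circlePt).mul continuous_const)
  have hlip : ∀ x, ‖g (r' * circlePt x) - g (r * circlePt x)‖ ≤ M * |r' - r| := fun x => by
    have := (convex_ball (0 : ℂ) 1).norm_image_sub_le_of_norm_hasDerivWithin_le
      (fun z hz => (hg z hz).hasDerivWithinAt) hM (mul_circlePt_mem_ball hr x)
      (mul_circlePt_mem_ball hr' x)
    refine this.trans (le_of_eq ?_)
    rw [← sub_mul, norm_mul, norm_circlePt, mul_one, ← Complex.ofReal_sub, Complex.norm_real,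
      Real.norm_eq_abs]
  rw [key r hr, key r' hr']
  calc ‖g (r' * circlePt t) - g (r' * circlePt s) - (g (r * circlePt t) - g (r * circlePt s))‖
      = ‖(g (r' * circlePt t) - g (r * circlePt t)) -
          (g (r' * circlePt s) - g (r * circlePt s))‖ := by ring_nf
    _ ≤ M * |r' - r| + M * |r' - r| := (norm_sub_le _ _).trans (add_le_add (hlip t) (hlip s))
    _ = 2 * M * |r' - r| := by ring

/-- The integral along a boundary arc is approximated by the integral along the concentric arc of
radius `r`, with an error controlled by the maximum of the function alone. -/
theorem norm_integral_boundaryPt_sub_le (hD : IsCurveDomain D) (hφ : IsRiemannMap D φ) {M : ℝ}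
    (hM : ∀ t, ‖boundaryPt φ t‖ ≤ M) {r : ℝ} (hr : r ∈ Ico (0 : ℝ) 1) (s t : ℝ) :
    ‖(∫ x in s..t, boundaryPt φ x * (circlePt x * Complex.I)) -
      ∫ x in s..t, φ (r * circlePt x) * (r * circlePt x * Complex.I)‖ ≤ 2 * M * (1 - r) := by
  have hMb : ∀ z ∈ ball (0 : ℂ) 1, ‖φ z‖ ≤ M := fun z hz => norm_le_of_norm_boundaryPt_le hD hφ hM hz
  have hM0 : 0 ≤ M := (norm_nonneg _).trans (hM 0)
  have hlt : ∀ᶠ r' : ℝ in 𝓝[<] 1, r' ∈ Ico (0 : ℝ) 1 := by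
    filter_upwards [Ioo_mem_nhdsLT (zero_lt_one' ℝ)] with u hu using ⟨hu.1.le, hu.2⟩
  have hlim : Tendsto (fun r' : ℝ =>
      ∫ x in s..t, φ (r' * circlePt x) * (r' * circlePt x * Complex.I)) (𝓝[<] 1)
      (𝓝 (∫ x in s..t, boundaryPt φ x * (circlePt x * Complex.I))) := by
    refine intervalIntegral.tendsto_integral_filter_of_dominated_convergence (fun _ => M)
      ?_ ?_ intervalIntegrable_const (.of_forall fun x _ => ?_)
    · filter_upwards [hlt] with u hu
      exact ((continuous_comp_mul_circlePt hφ.differentiableOn hu).mul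
        ((continuous_const.mul continuous_circlePt).mul continuous_const)).aestronglyMeasurable
    · filter_upwards [hlt] with u hu
      refine .of_forall fun x _ => ?_
      rw [norm_mul, norm_mul, norm_mul, norm_circlePt, Complex.norm_I, Complex.norm_real,
        Real.norm_of_nonneg hu.1]
      have := hMb _ (mul_circlePt_mem_ball hu x)
      rw [mul_one, mul_one]
      exact (mul_le_of_le_one_right (norm_nonneg _) hu.2.le).trans this
    · have h1 : Tendsto (fun u : ℝ => (u : ℂ) * circlePt x) (𝓝[<] 1) (𝓝 (circlePt x)) := by
        have : Continuous fun u : ℝ => (u : ℂ) * circlePt x := by fun_prop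
        simpa using (this.tendsto 1).mono_left (nhdsWithin_le_nhds (s := Iio 1))
      have h2 : Tendsto (fun u : ℝ => (u : ℂ) * circlePt x) (𝓝[<] 1)
          (𝓝[ball 0 1] circlePt x) :=
        tendsto_nhdsWithin_iff.2 ⟨h1, hlt.mono fun u hu => mul_circlePt_mem_ball hu x⟩
      exact ((tendsto_boundaryPt hD hφ x).comp h2).mul (h1.mul_const _)
  refine le_of_tendsto (hlim.sub_const _).norm ?_
  filter_upwards [hlt, Ioo_mem_nhdsLT hr.2] with u hu hu'
  refine (norm_integral_sub_integral_le hφ.differentiableOn hMb hr hu s t).trans ?_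
  rw [abs_of_pos (sub_pos.2 hu'.1)]
  gcongr
  exact hu.2.le

end Radial

namespace ConvergentMatching

variable {D : ℕ → Set ℂ} {φ : ℕ → ℂ → ℂ} {c d a : ℕ → ℝ} {D' : Set ℂ} {φ' : ℂ → ℂ}
  {c' d' a' : ℝ} {ε : ℕ → ℝ} {k : ℕ → ℝ → ℝ} {C : ℝ} {K : ℝ → ℝ}

/-- The arc is replaced by one of radius `r < 1`, with an error uniform in `n`; on that arc the
Riemann maps converge. -/
theorem tendsto_integral_boundaryPt (h : ConvergentMatching D φ c d a D' φ' c' d' a' ε k C K)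
    (s t : ℝ) :
    Tendsto (fun n => ∫ x in s..t, boundaryPt (φ n) x * (circlePt x * Complex.I)) atTop
      (𝓝 (∫ x in s..t, boundaryPt φ' x * (circlePt x * Complex.I))) := by
  obtain ⟨M, hM, hMn, hM'⟩ := h.exists_bound
  rw [Metric.tendsto_nhds]
  intro η hη
  obtain ⟨r, hr, hrη⟩ : ∃ r ∈ Ico (0 : ℝ) 1, 2 * M * (1 - r) ≤ η / 3 := by
    refine ⟨max 0 (1 - η / (6 * M)), ⟨le_max_left _ _, max_lt one_pos ?_⟩, ?_⟩
    · have : 0 < η / (6 * M) := by positivity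
      linarith
    · have : 1 - max 0 (1 - η / (6 * M)) ≤ η / (6 * M) := by
        linarith [le_max_right 0 (1 - η / (6 * M))]
      calc 2 * M * (1 - max 0 (1 - η / (6 * M))) ≤ 2 * M * (η / (6 * M)) := by gcongr
        _ = η / 3 := by field_simp; norm_num
  have hlim : Tendsto (fun n => ∫ x in s..t, φ n (r * circlePt x) * (r * circlePt x * Complex.I))
      atTop (𝓝 (∫ x in s..t, φ' (r * circlePt x) * (r * circlePt x * Complex.I))) := by
    refine intervalIntegral.tendsto_integral_filter_of_dominated_convergence
      (fun _ => M) (.of_forall fun n => ?_) (.of_forall fun n => .of_forall fun x _ => ?_)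
      intervalIntegrable_const (.of_forall fun x _ => ?_)
    · exact ((continuous_comp_mul_circlePt (h.map n).differentiableOn hr).mul
        ((continuous_const.mul continuous_circlePt).mul continuous_const)).aestronglyMeasurable
    · rw [norm_mul, norm_mul, norm_mul, norm_circlePt, Complex.norm_I, Complex.norm_real,
        Real.norm_of_nonneg hr.1]
      have := norm_le_of_norm_boundaryPt_le (h.dom n) (h.map n) (hMn n) (mul_circlePt_mem_ball hr x)
      rw [mul_one, mul_one]
      exact (mul_le_of_le_one_right (norm_nonneg _) hr.2.le).trans this
    · exact (h.tendstoLocallyUniformlyOn.tendsto_at (mul_circlePt_mem_ball hr x)).mul_const _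
  filter_upwards [Metric.tendsto_nhds.1 hlim (η / 3) (by positivity)] with n hn
  have h1 := norm_integral_boundaryPt_sub_le (h.dom n) (h.map n) (hMn n) hr s t
  have h2 := norm_integral_boundaryPt_sub_le h.dom' h.map' hM' hr s t
  rw [← dist_eq_norm] at h1 h2
  rw [dist_comm] at h2
  refine (dist_triangle4 _ (∫ x in s..t, φ n (r * circlePt x) * (r * circlePt x * Complex.I))
    (∫ x in s..t, φ' (r * circlePt x) * (r * circlePt x * Complex.I)) _).trans_lt ?_
  linarith

open MeasureTheory in
theorem tendsto_integral_boundaryPt_comp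
    (h : ConvergentMatching D φ c d a D' φ' c' d' a' ε k C K) {t : ℝ}
    (ht : t ∈ Icc C (C + 2 * Real.pi)) :
    Tendsto (fun n => ∫ x in C..t, boundaryPt (φ n) x * (circlePt x * Complex.I)) atTop
      (𝓝 (∫ x in C..t, boundaryPt φ' (K x) * (circlePt x * Complex.I))) := by
  obtain ⟨M, hM, hMn, hM'⟩ := h.exists_bound
  refine intervalIntegral.tendsto_integral_filter_of_dominated_convergence
    (fun _ => M) (.of_forall fun n => ?_) (.of_forall fun n => .of_forall fun x _ => ?_)
    intervalIntegrable_const ?_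
  · exact ((continuous_boundaryPt (h.dom n) (h.map n)).mul
      (continuous_circlePt.mul continuous_const)).aestronglyMeasurable
  · rw [norm_mul, norm_mul, norm_circlePt, Complex.norm_I, mul_one, mul_one]
    exact hMn n x
  · filter_upwards [h.ae_tendsto_boundaryPt] with x hx hxm
    rw [uIoc_of_le ht.1] at hxm
    exact (hx ⟨hxm.1, hxm.2.trans ht.2⟩).mul_const _

open MeasureTheory in
/-- The limit of the matchings is a reparametrization of the limit curve. -/
theorem boundaryPt_eq (h : ConvergentMatching D φ c d a D' φ' c' d' a' ε k C K) {t : ℝ}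
    (ht : t ∈ Ioo C (C + 2 * Real.pi)) (hK : ContinuousAt K t) :
    boundaryPt φ' t = boundaryPt φ' (K t) := by
  obtain ⟨M, hM, hMn, hM'⟩ := h.exists_bound
  have hQ := continuous_boundaryPt h.dom' h.map'
  set u : ℝ → ℂ := fun x => boundaryPt φ' x * (circlePt x * Complex.I) with hu
  set v : ℝ → ℂ := fun x => boundaryPt φ' (K x) * (circlePt x * Complex.I) with hv
  -- Both sides are the limit of the same integrals. Differentiation at the continuity point `t`
  -- removes the integral.
  have heq : ∀ y ∈ Icc C (C + 2 * Real.pi), ∫ x in C..y, u x = ∫ x in C..y, v x := fun y hy =>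
    tendsto_nhds_unique (h.tendsto_integral_boundaryPt C y) (h.tendsto_integral_boundaryPt_comp hy)
  have huc : Continuous u := hQ.mul (continuous_circlePt.mul continuous_const)
  have hvm : Measurable v := h.measurable_boundaryPt_comp.mul
    (continuous_circlePt.mul continuous_const).measurable
  have hvi : IntervalIntegrable v volume C t := by
    refine (intervalIntegrable_const (c := M)).mono_fun hvm.aestronglyMeasurable
      (.of_forall fun x => ?_)
    simp only [hv, norm_mul, norm_circlePt, Complex.norm_I, mul_one, Real.norm_of_nonneg hM.le]
    exact hM' _
  have hvc : ContinuousAt v t := ContinuousAt.mul (hQ.continuousAt.comp hK)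
    (continuous_circlePt.mul continuous_const).continuousAt
  have d1 := intervalIntegral.integral_hasDerivAt_right (huc.intervalIntegrable C t)
    huc.stronglyMeasurable.stronglyMeasurableAtFilter huc.continuousAt
  have d2 := intervalIntegral.integral_hasDerivAt_right hvi
    hvm.stronglyMeasurable.stronglyMeasurableAtFilter hvc
  have hev : (fun y => ∫ x in C..y, u x) =ᶠ[𝓝 t] fun y => ∫ x in C..y, v x := by
    filter_upwards [Ioo_mem_nhds ht.1 ht.2] with y hy using heq y (Ioo_subset_Icc_self hy)
  have huv : u t = v t := d1.unique (d2.congr_of_eventuallyEq hev)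
  refine mul_right_cancel₀ (mul_ne_zero ?_ Complex.I_ne_zero) huv
  exact norm_ne_zero_iff.1 (by rw [norm_circlePt]; exact one_ne_zero)

end ConvergentMatching

/-! ### Injectivity of the boundary curve on arcs -/

/-- The open interval for `t` excludes the one coincidence allowed to a simple curve, that of its
two end points. -/
theorem IsSimpleCurve.boundaryPt_inj {φ : ℂ → ℂ} {x y : ℝ} (hxy : x < y)
    (h : IsSimpleCurve (boundaryArc φ x y)) {s t : ℝ} (hs : s ∈ Icc x y) (ht : t ∈ Ioo x y)
    (hst : boundaryPt φ s = boundaryPt φ t) : s = t := by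
  have hd : 0 < y - x := sub_pos.2 hxy
  have hmem : ∀ u ∈ Icc x y, (u - x) / (y - x) ∈ Icc (0 : ℝ) 1 := fun u hu =>
    ⟨div_nonneg (by linarith [hu.1]) hd.le, (div_le_one hd).2 (by linarith [hu.2])⟩
  have hval : ∀ (u : ℝ) (hu : u ∈ Icc x y),
      boundaryArc φ x y ⟨(u - x) / (y - x), hmem u hu⟩ = boundaryPt φ u := fun u hu => by
    simp only [boundaryArc]
    congr 1
    field_simp
    ring
  have ht' := Ioo_subset_Icc_self ht
  have hst' := (hval s hs).trans (hst.trans (hval t ht').symm)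
  have hlt : ∀ u v : ℝ, u < v → (u - x) / (y - x) < (v - x) / (y - x) := fun u v huv =>
    div_lt_div_of_pos_right (by linarith) hd
  rcases lt_trichotomy s t with hlt' | heq | hlt'
  · have := (h.2 ⟨_, hmem s hs⟩ ⟨_, hmem t ht'⟩ (hlt s t hlt') hst').2
    have h1 : (t - x) / (y - x) = 1 := congrArg Subtype.val this
    rw [div_eq_one_iff_eq hd.ne'] at h1
    linarith [ht.2]
  · exact heq
  · have := (h.2 ⟨_, hmem t ht'⟩ ⟨_, hmem s hs⟩ (hlt t s hlt') hst'.symm).1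
    have h1 : (t - x) / (y - x) = 0 := congrArg Subtype.val this
    rw [div_eq_zero_iff, or_iff_left hd.ne'] at h1
    linarith [ht.1]

theorem exists_boundaryArc_eq (φ : ℂ → ℂ) {x y t : ℝ} (ht : t ∈ Icc x y) (hxy : x < y) :
    ∃ u : unitInterval, boundaryArc φ x y u = boundaryPt φ t ∧ (x < t → 0 < u) ∧
      (t < y → u < 1) := by
  have hd : 0 < y - x := sub_pos.2 hxy
  refine ⟨⟨(t - x) / (y - x), div_nonneg (by linarith [ht.1]) hd.le,
    (div_le_one hd).2 (by linarith [ht.2])⟩, ?_, fun h => ?_, fun h => ?_⟩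
  · simp only [boundaryArc]
    congr 1
    field_simp
    ring
  · exact Subtype.mk_lt_mk.2 (div_pos (by linarith) hd)
  · exact Subtype.mk_lt_mk.2 ((div_lt_one hd).2 (by linarith))

namespace IsAdmissible

variable {D : Set ℂ} {φ : ℂ → ℂ} {α γ δ : ℝ}

theorem simple_ac_shift (h : IsAdmissible D φ α γ δ) :
    IsSimpleCurve (boundaryArc φ (α + 2 * Real.pi) (γ + 2 * Real.pi)) := by
  have e := boundaryArc_add_int_mul φ α γ 1
  simp only [Int.cast_one, one_mul] at e
  rw [e]
  exact h.simple_ac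

/-- A point of the open arc `cd`, other than `a`, is not a double point of the boundary. -/
theorem boundaryPt_inj (h : IsAdmissible D φ α γ δ) {s t : ℝ} (ht : t ∈ Ioo γ δ)
    (hs : s ∈ Icc γ (γ + 2 * Real.pi)) (hta : boundaryPt φ t ≠ boundaryPt φ (α + 2 * Real.pi))
    (hst : boundaryPt φ s = boundaryPt φ t) : s = t := by
  obtain ⟨u, hu, -, -⟩ := exists_boundaryArc_eq φ (Ioo_subset_Icc_self ht) h.lt_cd
  rcases le_or_gt s δ with h1 | h1
  · exact h.simple_cd.boundaryPt_inj h.lt_cd ⟨hs.1, h1⟩ ht hst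
  rcases lt_trichotomy s (α + 2 * Real.pi) with h2 | h2 | h2
  · obtain ⟨v, hv, hv0, hv1⟩ := exists_boundaryArc_eq φ ⟨h1.le, h2.le⟩ h.lt_da
    exact absurd (hu.trans (hst.symm.trans hv.symm)) (h.not_touch_da u v (hv0 h1) (hv1 h2))
  -- As an end point of both `da` and `ac`, the point `a` is in the interior of neither, and
  -- admissibility does not keep it off `cd`.
  · exact absurd (h2 ▸ hst).symm hta
  rcases hs.2.lt_or_eq with h3 | h3
  · obtain ⟨v, hv, hv0, hv1⟩ := exists_boundaryArc_eq φ (x := α) (y := γ) (t := s - 2 * Real.pi)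
      ⟨by linarith, by linarith⟩ h.lt_ac
    have hv' : boundaryArc φ α γ v = boundaryPt φ s := by
      rw [hv, ← boundaryPt_add_two_pi]
      congr 1
      ring
    exact absurd (hu.trans (hst.symm.trans hv'.symm))
      (h.not_touch_ac u v (hv0 (by linarith)) (hv1 (by linarith)))
  · rw [h3, boundaryPt_add_two_pi] at hst
    have := h.simple_cd.boundaryPt_inj h.lt_cd (left_mem_Icc.2 h.lt_cd.le) ht hst
    linarith [ht.1]

/-- The boundary curve is not constant on any interval. -/
theorem not_const (h : IsAdmissible D φ α γ δ) {x y : ℝ} (hxy : x < y) (p : ℂ)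
    (hp : ∀ t ∈ Ioo x y, boundaryPt φ t = p) : False := by
  obtain ⟨m, hm, -⟩ := existsUnique_add_zsmul_mem_Ico Real.two_pi_pos ((x + y) / 2) γ
  rw [zsmul_eq_mul] at hm
  set b : ℝ := m * (2 * Real.pi) with hb
  set t₀ := (x + y) / 2 + b with ht₀
  have hp' : ∀ t ∈ Ioo (x + b) (y + b), boundaryPt φ t = p := fun t ht => by
    rw [← hp (t - b) ⟨by linarith [ht.1], by linarith [ht.2]⟩,
      ← boundaryPt_add_int_mul φ (t - b) m]
    congr 1
    rw [← hb]
    ring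
  -- Just to the right of `t₀` a simple arc would take the value `p` at two interior parameters.
  have key : ∀ u v : ℝ, u < v → IsSimpleCurve (boundaryArc φ u v) → t₀ ∈ Ico u v → False := by
    intro u v huv hs ht
    obtain ⟨t₁, h1, h1'⟩ := exists_between (lt_min ht.2 (show t₀ < y + b by linarith))
    obtain ⟨t₂, h2, h2'⟩ := exists_between h1
    rw [lt_min_iff] at h1'
    have e := hs.boundaryPt_inj huv (s := t₂) (t := t₁) ⟨by linarith [ht.1], by linarith⟩
      ⟨by linarith [ht.1], h1'.1⟩
      ((hp' t₂ ⟨by linarith, by linarith⟩).trans (hp' t₁ ⟨by linarith, by linarith⟩).symm)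
    linarith
  rcases lt_or_ge t₀ δ with h1 | h1
  · exact key γ δ h.lt_cd h.simple_cd ⟨hm.1, h1⟩
  rcases lt_or_ge t₀ (α + 2 * Real.pi) with h2 | h2
  · exact key δ _ h.lt_da h.simple_da ⟨h1, h2⟩
  · exact key _ _ (by linarith [h.lt_ac]) h.simple_ac_shift ⟨h2, hm.2⟩

end IsAdmissible

/-! ### Identification of the limit parametrization -/

/-- The complement of `S` is dense, so monotonicity squeezes `K t` between values of `s + b` with
`s` arbitrarily near `t`. -/
theorem eq_add_of_monotone_of_countable {K : ℝ → ℝ} (hK : Monotone K) {x y b : ℝ} {S : Set ℝ}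
    (hS : S.Countable) (h : ∀ t ∈ Ioo x y, t ∉ S → K t = t + b) {t : ℝ} (ht : t ∈ Ioo x y) :
    K t = t + b := by
  have hdense : ∀ u v : ℝ, u < v → ∃ w ∈ Ioo u v, w ∉ S := fun u v huv => by
    obtain ⟨w, hw, hw'⟩ := (hS.dense_compl ℝ).exists_between huv
    exact ⟨w, hw', hw⟩
  refine le_antisymm (le_of_forall_pos_le_add fun e he => ?_) (le_of_forall_pos_le_add fun e he => ?_)
  · obtain ⟨w, hw, hwS⟩ := hdense t (min y (t + e)) (lt_min ht.2 (by linarith))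
    have hw2 := lt_min_iff.1 hw.2
    have := h w ⟨ht.1.trans hw.1, hw2.1⟩ hwS
    linarith [hK hw.1.le]
  · obtain ⟨w, hw, hwS⟩ := hdense (max x (t - e)) t (max_lt ht.1 (by linarith))
    have hw1 := max_lt_iff.1 hw.1
    have := h w ⟨hw1.1, hw.2.trans ht.2⟩ hwS
    linarith [hK hw.2.le]

namespace ConvergentMatching

variable {D : ℕ → Set ℂ} {φ : ℕ → ℂ → ℂ} {c d a : ℕ → ℝ} {D' : Set ℂ} {φ' : ℂ → ℂ}
  {α' γ' δ' : ℝ} {ε : ℕ → ℝ} {k : ℕ → ℝ → ℝ} {C : ℝ} {K : ℝ → ℝ}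

theorem exists_continuousAt_Ioo (hK : Monotone K) {u v : ℝ} (huv : u < v) :
    ∃ w ∈ Ioo u v, ContinuousAt K w := by
  obtain ⟨w, hw, hw'⟩ := (hK.countable_not_continuousAt.dense_compl ℝ).exists_between huv
  exact ⟨w, hw', not_not.1 hw⟩

/-- On a flat interval `K` is continuous, so the boundary curve, equal to its composition with `K`,
would be constant there. Every wrong position of a marked point is refuted by such an interval. -/
theorem not_const (h : ConvergentMatching D φ c d a D' φ' γ' δ' (α' + 2 * Real.pi) ε k C K)
    (hA : IsAdmissible D' φ' α' γ' δ') {x y v : ℝ} (hxy : x < y) (hx : C ≤ x)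
    (hy : y ≤ C + 2 * Real.pi) (hv : ∀ t ∈ Ioo x y, K t = v) : False := by
  refine hA.not_const hxy (boundaryPt φ' v) fun t ht => ?_
  have hc : ContinuousAt K t := by
    have : K =ᶠ[𝓝 t] fun _ => v := by
      filter_upwards [Ioo_mem_nhds ht.1 ht.2] with s hs using hv s hs
    exact this.continuousAt
  rw [h.boundaryPt_eq ⟨hx.trans_lt ht.1, ht.2.trans_le hy⟩ hc, hv t ht]

theorem K_mem_Icc (h : ConvergentMatching D φ c d a D' φ' γ' δ' (α' + 2 * Real.pi) ε k C K)
    (t : ℝ) : K t ∈ Icc γ' (γ' + 2 * Real.pi) := by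
  obtain ⟨u, hu, huc⟩ := exists_continuousAt_Ioo h.mono (show t - 1 < t by linarith)
  obtain ⟨v, hv, hvc⟩ := exists_continuousAt_Ioo h.mono (show t < t + 1 by linarith)
  exact ⟨(ge_of_tendsto' (h.tendsto_k u huc) fun n => ((h.matching n).mem_Icc u).1).trans
      (h.mono hu.2.le),
    (h.mono hv.1.le).trans (le_of_tendsto' (h.tendsto_k v hvc) fun n =>
      ((h.matching n).mem_Icc v).2)⟩

/-- The limit parametrization is the identity, up to a multiple of `2π`, on the arc `cd`. -/
theorem K_eq_on_cd (h : ConvergentMatching D φ c d a D' φ' γ' δ' (α' + 2 * Real.pi) ε k C K)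
    (hA : IsAdmissible D' φ' α' γ' δ') (m : ℤ) {t : ℝ} (ht : t ∈ Ioo C (C + 2 * Real.pi))
    (ht' : t - m * (2 * Real.pi) ∈ Ioo γ' δ') : K t = t - m * (2 * Real.pi) := by
  set b : ℝ := m * (2 * Real.pi) with hb
  -- Besides the discontinuities, this excludes the parameter, at most one since `cd` is simple, at
  -- which the open arc `cd` passes through `a`.
  set S : Set ℝ := {t | ¬ContinuousAt K t} ∪
    {t | t - b ∈ Ioo γ' δ' ∧ boundaryPt φ' (t - b) = boundaryPt φ' (α' + 2 * Real.pi)} with hS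
  have hScount : S.Countable := by
    refine h.mono.countable_not_continuousAt.union (Set.Subsingleton.countable ?_)
    rintro x ⟨hx, hx'⟩ y ⟨hy, hy'⟩
    have := hA.simple_cd.boundaryPt_inj hA.lt_cd (Ioo_subset_Icc_self hx) hy (hx'.trans hy'.symm)
    linarith
  have := eq_add_of_monotone_of_countable h.mono (x := max C (γ' + b))
    (y := min (C + 2 * Real.pi) (δ' + b)) (b := -b) hScount (fun s hs hsS => ?_) (t := t)
    ⟨max_lt ht.1 (by linarith [ht'.1]), lt_min ht.2 (by linarith [ht'.2])⟩
  · rw [this]; ring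
  · have h1 := max_lt_iff.1 hs.1
    have h2 := lt_min_iff.1 hs.2
    simp only [hS, mem_union, mem_ofPred_eq, not_or, not_not, not_and] at hsS
    have hsm : s - b ∈ Ioo γ' δ' := ⟨by linarith [h1.2], by linarith [h2.2]⟩
    have e := h.boundaryPt_eq ⟨h1.1, h2.1⟩ hsS.1
    have e' : boundaryPt φ' (s - b) = boundaryPt φ' s := by
      rw [← boundaryPt_add_int_mul φ' (s - b) m, ← hb, sub_add_cancel]
    rw [← sub_eq_add_neg]
    exact hA.boundaryPt_inj hsm (h.K_mem_Icc s) (hsS.2 hsm) (e.symm.trans e'.symm)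

/-- If `C < γ'`, then on `(C, γ')` the function `K` is at least `γ'`, and at most `γ'` because it is
the identity just after `γ'`. If `C > γ'`, then `K t = t - 2π` just after `γ' + 2π`, so `K` equals
`γ'` on `(C, γ' + 2π)`. Both contradict `not_const`. -/
theorem C_eq (h : ConvergentMatching D φ c d a D' φ' γ' δ' (α' + 2 * Real.pi) ε k C K)
    (hA : IsAdmissible D' φ' α' γ' δ') (hC : C ∈ Icc (γ' - Real.pi) (γ' + Real.pi)) : C = γ' := by
  have hpi := Real.pi_pos
  have hcd := hA.lt_cd
  rcases lt_trichotomy C γ' with hlt | heq | hlt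
  · exfalso
    refine h.not_const hA (x := C) (y := γ') (v := γ') hlt le_rfl (by linarith [hC.1])
      fun t ht => le_antisymm (le_of_forall_pos_le_add fun e he => ?_) (h.K_mem_Icc t).1
    obtain ⟨s, hs, hs'⟩ := exists_between (lt_min (lt_min (show γ' < δ' from hcd)
      (show γ' < C + 2 * Real.pi by linarith [hC.1])) (show γ' < γ' + e by linarith))
    rw [lt_min_iff, lt_min_iff] at hs'
    have := h.K_eq_on_cd hA 0 (t := s) ⟨by linarith, hs'.1.2⟩
      (by simpa using ⟨hs, hs'.1.1⟩)
    simp only [Int.cast_zero, zero_mul, sub_zero] at this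
    linarith [h.mono (show t ≤ s by linarith [ht.2])]
  · exact heq
  · exfalso
    refine h.not_const hA (x := C) (y := γ' + 2 * Real.pi) (v := γ') (by linarith [hC.2]) le_rfl
      (by linarith) fun t ht =>
        le_antisymm (le_of_forall_pos_le_add fun e he => ?_) (h.K_mem_Icc t).1
    obtain ⟨s, hs, hs'⟩ := exists_between (lt_min (lt_min (show γ' + 2 * Real.pi < δ' + 2 * Real.pi
      by linarith) (show γ' + 2 * Real.pi < C + 2 * Real.pi by linarith))
      (show γ' + 2 * Real.pi < γ' + 2 * Real.pi + e by linarith))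
    rw [lt_min_iff, lt_min_iff] at hs'
    have := h.K_eq_on_cd hA 1 (t := s) ⟨by linarith [hC.2], hs'.1.2⟩
      ⟨by simp; linarith, by simp; linarith⟩
    simp only [Int.cast_one, one_mul] at this
    linarith [h.mono (show t ≤ s by linarith [ht.2])]

theorem K_le_of_lt {X : ℝ} {x : ℕ → ℝ} {v : ℝ}
    (h : ConvergentMatching D φ c d a D' φ' γ' δ' (α' + 2 * Real.pi) ε k C K)
    (hx : Tendsto x atTop (𝓝 X)) (hk : ∀ n, ∀ t ≤ x n, k n t ≤ v) {t : ℝ} (ht : t < X) :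
    K t ≤ v := by
  obtain ⟨s, hs, hsc⟩ := exists_continuousAt_Ioo h.mono ht
  refine (h.mono hs.1.le).trans (le_of_tendsto (h.tendsto_k s hsc) ?_)
  filter_upwards [hx.eventually (lt_mem_nhds hs.2)] with n hn using hk n s hn.le

theorem le_K_of_lt {X : ℝ} {x : ℕ → ℝ} {v : ℝ}
    (h : ConvergentMatching D φ c d a D' φ' γ' δ' (α' + 2 * Real.pi) ε k C K)
    (hx : Tendsto x atTop (𝓝 X)) (hk : ∀ n t, x n ≤ t → v ≤ k n t) {t : ℝ} (ht : X < t) :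
    v ≤ K t := by
  obtain ⟨s, hs, hsc⟩ := exists_continuousAt_Ioo h.mono ht
  refine le_trans (ge_of_tendsto (h.tendsto_k s hsc) ?_) (h.mono hs.2.le)
  filter_upwards [hx.eventually (gt_mem_nhds hs.1)] with n hn using hk n s hn.le

/-- On a simple arc that the limit parametrization maps to itself it is the identity. -/
theorem K_eq_of_mem_Icc
    (h : ConvergentMatching D φ c d a D' φ' γ' δ' (α' + 2 * Real.pi) ε k C K) {x y : ℝ}
    (hs : IsSimpleCurve (boundaryArc φ' x y)) (hx : C ≤ x) (hy : y ≤ C + 2 * Real.pi)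
    (hK : ∀ t ∈ Ioo x y, K t ∈ Icc x y) {t : ℝ} (ht : t ∈ Ioo x y) : K t = t := by
  have := eq_add_of_monotone_of_countable h.mono (x := x) (y := y) (b := 0)
    h.mono.countable_not_continuousAt (fun s hs' hsS => ?_) ht
  · rw [this, add_zero]
  · rw [add_zero]
    have e := h.boundaryPt_eq ⟨hx.trans_lt hs'.1, hs'.2.trans_le hy⟩ (not_not.1 hsS)
    exact hs.boundaryPt_inj (hs'.1.trans hs'.2) (hK s hs') hs' e.symm

/-- Since `K` crosses the level `δ'` at `d₀`, the case `d₀ < δ'` contradicts `K = id` on `cd`, and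
`d₀ > δ'` makes `K` flat between `δ'` and `d₀`. If `a₀` is too small, `K` maps the shifted arc `ac`
to itself; if it is too large, the arc `da`. By simplicity `K` is the identity on that arc, and it
is flat next to it. -/
theorem limits_eq (h : ConvergentMatching D φ c d a D' φ' γ' δ' (α' + 2 * Real.pi) ε k C K)
    (hA : IsAdmissible D' φ' α' γ' δ') (hC : C = γ') {d₀ a₀ : ℝ}
    (hd : Tendsto d atTop (𝓝 d₀)) (ha : Tendsto a atTop (𝓝 a₀)) :
    d₀ = δ' ∧ a₀ = α' + 2 * Real.pi := by
  have hcd := hA.lt_cd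
  have hda := hA.lt_da
  have hac := hA.lt_ac
  have hKcd : ∀ t ∈ Ioo γ' δ', K t = t := fun t ht => by
    have := h.K_eq_on_cd hA 0 (t := t) ⟨by linarith [ht.1], by linarith [ht.2]⟩
      (by simpa using ht)
    simpa using this
  have hd_le : ∀ t < d₀, K t ≤ δ' := fun t ht => h.K_le_of_lt hd (fun n => (h.matching n).le_d) ht
  have hd_ge : ∀ t, d₀ < t → δ' ≤ K t := fun t ht =>
    h.le_K_of_lt hd (fun n => (h.matching n).ge_d) ht
  have ha_le : ∀ t < a₀, K t ≤ α' + 2 * Real.pi := fun t ht =>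
    h.K_le_of_lt ha (fun n => (h.matching n).le_a) ht
  have ha_ge : ∀ t, a₀ < t → α' + 2 * Real.pi ≤ K t := fun t ht =>
    h.le_K_of_lt ha (fun n => (h.matching n).ge_a) ht
  have hd₀ : d₀ = δ' := by
    rcases lt_trichotomy d₀ δ' with hlt | heq | hlt
    · exfalso
      obtain ⟨t, ht, ht'⟩ := exists_between (max_lt hlt hcd)
      rw [max_lt_iff] at ht
      have := hd_ge t ht.1
      rw [hKcd t ⟨ht.2, ht'⟩] at this
      linarith
    · exact heq
    · exfalso
      refine h.not_const hA (x := δ') (y := min d₀ (γ' + 2 * Real.pi)) (v := δ')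
        (lt_min hlt (by linarith)) (by linarith) (by rw [hC]; exact min_le_right _ _)
        fun t ht => ?_
      have ht2 := lt_min_iff.1 ht.2
      refine le_antisymm (hd_le t ht2.1) (le_of_forall_pos_le_add fun e he => ?_)
      obtain ⟨s, hs, hs'⟩ := exists_between (max_lt hcd (show δ' - e < δ' by linarith))
      rw [max_lt_iff] at hs
      have := h.mono (show s ≤ t by linarith [ht.1])
      rw [hKcd s ⟨hs.1, hs'⟩] at this
      linarith
  refine ⟨hd₀, ?_⟩
  subst hd₀
  rcases lt_trichotomy a₀ (α' + 2 * Real.pi) with hlt | heq | hlt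
  · exfalso
    have hid : ∀ t ∈ Ioo (α' + 2 * Real.pi) (γ' + 2 * Real.pi), K t = t := fun t ht =>
      h.K_eq_of_mem_Icc hA.simple_ac_shift (by linarith) (by linarith)
        (fun s hs => ⟨ha_ge s (by linarith [hs.1]), (h.K_mem_Icc s).2⟩) ht
    refine h.not_const hA (x := max a₀ d₀) (y := α' + 2 * Real.pi) (v := α' + 2 * Real.pi)
      (max_lt hlt hda) (le_trans (by linarith) (le_max_right _ _)) (by linarith) fun t ht => ?_
    have ht1 := max_lt_iff.1 ht.1
    refine le_antisymm (le_of_forall_pos_le_add fun e he => ?_) (ha_ge t ht1.1)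
    obtain ⟨s, hs, hs'⟩ := exists_between (lt_min
      (show α' + 2 * Real.pi < γ' + 2 * Real.pi by linarith)
      (show α' + 2 * Real.pi < α' + 2 * Real.pi + e by linarith))
    rw [lt_min_iff] at hs'
    have := h.mono (show t ≤ s by linarith [ht.2])
    rw [hid s ⟨hs, hs'.1⟩] at this
    linarith
  · exact heq
  · exfalso
    have hid : ∀ t ∈ Ioo d₀ (α' + 2 * Real.pi), K t = t := fun t ht =>
      h.K_eq_of_mem_Icc hA.simple_da (by linarith) (by linarith)
        (fun s hs => ⟨hd_ge s hs.1, ha_le s (by linarith [hs.2])⟩) ht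
    refine h.not_const hA (x := α' + 2 * Real.pi) (y := min a₀ (γ' + 2 * Real.pi))
      (v := α' + 2 * Real.pi) (lt_min hlt (by linarith)) (by linarith)
      (by rw [hC]; exact min_le_right _ _) fun t ht => ?_
    have ht2 := lt_min_iff.1 ht.2
    refine le_antisymm (ha_le t ht2.1) (le_of_forall_pos_le_add fun e he => ?_)
    obtain ⟨s, hs, hs'⟩ := exists_between (max_lt hda
      (show α' + 2 * Real.pi - e < α' + 2 * Real.pi by linarith))
    rw [max_lt_iff] at hs
    have := h.mono (show s ≤ t by linarith [ht.1])
    rw [hid s ⟨hs.1, hs'⟩] at this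
    linarith

/-- Convergence of the parameter of a point of the arc `cd`. -/
theorem tendsto_of_tendsto_boundaryPt
    (h : ConvergentMatching D φ c d a D' φ' γ' δ' (α' + 2 * Real.pi) ε k C K)
    (hA : IsAdmissible D' φ' α' γ' δ') (hC : C = γ') {b : ℕ → ℝ} {b' : ℝ} (hb' : b' ∈ Ioo γ' δ')
    (hcb : ∀ n, c n ≤ b n) (hbd : ∀ n, b n ≤ d n) (hdc : ∀ n, d n ≤ c n + 2 * Real.pi)
    (hb : Tendsto (fun n => boundaryPt (φ n) (b n)) atTop (𝓝 (boundaryPt φ' b'))) :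
    Tendsto b atTop (𝓝 b') := by
  have hcd := hA.lt_cd
  have hda := hA.lt_da
  have hac := hA.lt_ac
  have hKcd : ∀ t ∈ Ioo γ' δ', K t = t := fun t ht => by
    have := h.K_eq_on_cd hA 0 (t := t) ⟨by linarith [ht.1], by linarith [ht.2]⟩
      (by simpa using ht)
    simpa using this
  have hkt : ∀ t ∈ Ioo γ' δ', Tendsto (fun n => k n t) atTop (𝓝 t) := fun t ht => by
    have hc : ContinuousAt K t := by
      have : K =ᶠ[𝓝 t] fun s => s := by
        filter_upwards [Ioo_mem_nhds ht.1 ht.2] with s hs using hKcd s hs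
      exact continuousAt_id.congr this.symm
    have := h.tendsto_k t hc
    rwa [hKcd t ht] at this
  have hQ := continuous_boundaryPt h.dom' h.map'
  have hQb : Tendsto (fun n => boundaryPt φ' (k n (b n))) atTop (𝓝 (boundaryPt φ' b')) := by
    refine (tendsto_iff_of_dist ?_).1 hb
    refine squeeze_zero (fun _ => dist_nonneg) (fun n => ?_) h.tendsto_eps
    exact (h.matching n).dist_le _ ⟨hcb n, (hbd n).trans (hdc n)⟩
  have hmem : ∀ n, k n (b n) ∈ Icc γ' δ' := fun n =>
    ⟨((h.matching n).mem_Icc _).1, (h.matching n).le_d _ (hbd n)⟩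
  -- On the compact parameter interval of `cd`, only `b'` gives the point `b`, since `cd` is simple
  -- and `b'` is not an end.
  have hk : Tendsto (fun n => k n (b n)) atTop (𝓝 b') := by
    rw [Metric.tendsto_nhds]
    intro e he
    obtain ⟨ρ, hρ, hmin⟩ := (isCompact_Icc.diff (isOpen_ball (x := b') (ε := e))).exists_forall_le'
      (s := Icc γ' δ' \ ball b' e) (f := fun s => dist (boundaryPt φ' s) (boundaryPt φ' b'))
      (Continuous.continuousOn (by fun_prop)) (a := 0) (fun s hs => by
        rw [dist_pos]
        intro heq
        have := hA.simple_cd.boundaryPt_inj hcd hs.1 hb' heq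
        exact hs.2 (this ▸ mem_ball_self he))
    filter_upwards [Metric.tendsto_nhds.1 hQb ρ hρ] with n hn
    by_contra hcon
    exact (hmin _ ⟨hmem n, hcon⟩).not_gt hn
  -- As `k n y → y` for `y` near `b'`, comparing `k n y` with `k n (b n)` compares `y` with `b n`,
  -- by monotonicity.
  refine tendsto_order.2 ⟨fun x hx => ?_, fun x hx => ?_⟩
  · obtain ⟨y, hy, hy'⟩ := exists_between (max_lt hx hb'.1)
    rw [max_lt_iff] at hy
    filter_upwards [(hkt y ⟨hy.2, hy'.trans hb'.2⟩).eventually_lt hk hy'] with n hn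
    exact hy.1.trans ((h.matching n).mono.reflect_lt hn)
  · obtain ⟨y, hy, hy'⟩ := exists_between (lt_min hx hb'.2)
    rw [lt_min_iff] at hy'
    filter_upwards [hk.eventually_lt (hkt y ⟨hb'.1.trans hy, hy'.2⟩) hy] with n hn
    exact ((h.matching n).mono.reflect_lt hn).trans hy'.1

end ConvergentMatching

/-! ### Continuity of Cardy's formula -/

theorem continuousAt_ordinaryHypergeometric {η : ℝ} (hη : |η| < 1) :
    ContinuousAt (ordinaryHypergeometric (1 / 3 : ℝ) (2 / 3 : ℝ) (4 / 3 : ℝ) : ℝ → ℝ) η := by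
  have hrad : (ordinaryHypergeometricSeries ℝ (1 / 3 : ℝ) (2 / 3) (4 / 3)).radius = 1 := by
    refine ordinaryHypergeometricSeries_radius_eq_one ℝ _ _ _ fun n => ?_
    have hn : (0 : ℝ) ≤ n := Nat.cast_nonneg n
    exact ⟨by linarith, by linarith, by linarith⟩
  have h := (ordinaryHypergeometricSeries ℝ (1 / 3 : ℝ) (2 / 3) (4 / 3)).hasFPowerSeriesOnBall
    (by rw [hrad]; exact one_pos)
  refine h.continuousOn.continuousAt (Metric.isOpen_eball.mem_nhds ?_)
  rw [hrad, Metric.mem_eball, edist_dist, dist_zero_right, Real.norm_eq_abs]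
  exact ENNReal.ofReal_lt_one.2 hη

theorem cardyPhi_eq (x y z w : ℝ) :
    cardyPhi x y z w = cardyFunction (Real.sin ((x - y) / 2) * Real.sin ((z - w) / 2) /
      (Real.sin ((x - z) / 2) * Real.sin ((y - w) / 2))) := by
  rw [cardyPhi, crossRatio_circlePt, Complex.ofReal_re]

theorem cardyPhi_add_int_mul (x y z w : ℝ) (m : ℤ) :
    cardyPhi (x + m * (2 * Real.pi)) (y + m * (2 * Real.pi)) (z + m * (2 * Real.pi))
      (w + m * (2 * Real.pi)) = cardyPhi x y z w := by
  simp only [cardyPhi, circlePt_add_int_mul]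

theorem sin_neg_of_Ioo {u : ℝ} (h : u ∈ Ioo (-(2 * Real.pi)) 0) : Real.sin (u / 2) < 0 :=
  Real.sin_neg_of_neg_of_neg_pi_lt (by linarith [h.2]) (by linarith [h.1])

theorem tendsto_cardyPhi {ι : Type*} {l : Filter ι} {x y z w : ι → ℝ} {x' y' z' w' : ℝ}
    (hx : Tendsto x l (𝓝 x')) (hy : Tendsto y l (𝓝 y')) (hz : Tendsto z l (𝓝 z'))
    (hw : Tendsto w l (𝓝 w')) (hxy : x' < y') (hyz : y' < z') (hzw : z' < w')
    (hwx : w' < x' + 2 * Real.pi) :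
    Tendsto (fun i => cardyPhi (x i) (y i) (z i) (w i)) l (𝓝 (cardyPhi x' y' z' w')) := by
  simp only [cardyPhi_eq]
  have n1 := sin_neg_of_Ioo (u := x' - y') ⟨by linarith, by linarith⟩
  have n2 := sin_neg_of_Ioo (u := z' - w') ⟨by linarith, by linarith⟩
  have n3 := sin_neg_of_Ioo (u := x' - z') ⟨by linarith, by linarith⟩
  have n4 := sin_neg_of_Ioo (u := y' - w') ⟨by linarith, by linarith⟩
  have n5 := sin_neg_of_Ioo (u := y' - z') ⟨by linarith, by linarith⟩
  have n6 := sin_neg_of_Ioo (u := x' - w') ⟨by linarith, by linarith⟩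
  have hnum := mul_pos_of_neg_of_neg n1 n2
  have hden := mul_pos_of_neg_of_neg n3 n4
  -- Ptolemy's identity: it shows `1 - η' > 0`, so `η'` is inside the disc of convergence of the
  -- hypergeometric series.
  have hptol : Real.sin ((x' - z') / 2) * Real.sin ((y' - w') / 2) -
      Real.sin ((x' - y') / 2) * Real.sin ((z' - w') / 2) =
      Real.sin ((y' - z') / 2) * Real.sin ((x' - w') / 2) := by
    have e1 : (x' - z') / 2 = (x' - y') / 2 + (y' - z') / 2 := by ring
    have e2 : (y' - w') / 2 = (y' - z') / 2 + (z' - w') / 2 := by ring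
    have e3 : (x' - w') / 2 = (x' - y') / 2 + (y' - z') / 2 + (z' - w') / 2 := by ring
    rw [e1, e2, e3]
    generalize (x' - y') / 2 = p
    generalize (y' - z') / 2 = q
    generalize (z' - w') / 2 = r
    simp only [Real.sin_add, Real.cos_add]
    linear_combination (Real.sin p * Real.sin r) * Real.sin_sq_add_cos_sq q
  have hdiff := mul_pos_of_neg_of_neg n5 n6
  set η' := Real.sin ((x' - y') / 2) * Real.sin ((z' - w') / 2) /
      (Real.sin ((x' - z') / 2) * Real.sin ((y' - w') / 2)) with hη'
  have hη0 : 0 < η' := div_pos hnum hden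
  have hη1 : η' < 1 := (div_lt_one hden).2 (by linarith)
  have hcont : ContinuousAt cardyFunction η' := by
    unfold cardyFunction
    refine ContinuousAt.mul (ContinuousAt.mul continuousAt_const ?_)
      (continuousAt_ordinaryHypergeometric (by rwa [abs_of_pos hη0]))
    exact Real.continuousAt_rpow_const _ _ (.inl hη0.ne')
  refine hcont.tendsto.comp (Tendsto.div ?_ ?_ hden.ne')
  · exact ((Real.continuous_sin.tendsto _).comp ((hx.sub hy).div_const 2)).mul
      ((Real.continuous_sin.tendsto _).comp ((hz.sub hw).div_const 2))
  · exact ((Real.continuous_sin.tendsto _).comp ((hx.sub hz).div_const 2)).mul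
      ((Real.continuous_sin.tendsto _).comp ((hy.sub hw).div_const 2))

/-- The convergence of Cardy's formula along a subsequence, for matched boundary curves. -/
theorem exists_subseq_tendsto_cardyPhi {D : ℕ → Set ℂ} {φ : ℕ → ℂ → ℂ} {α γ β δ : ℕ → ℝ}
    {D' : Set ℂ} {φ' : ℂ → ℂ} {α' γ' β' δ' : ℝ} {ε : ℕ → ℝ} {k : ℕ → ℝ → ℝ}
    (hD : ∀ n, IsCurveDomain (D n)) (hφ : ∀ n, IsRiemannMap (D n) (φ n))
    (hαγ : ∀ n, α n < γ n) (hδα : ∀ n, δ n < α n + 2 * Real.pi)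
    (hβ : ∀ n, β n ∈ Ioo (γ n) (δ n)) (hA : IsAdmissible D' φ' α' γ' δ') (hβ' : β' ∈ Ioo γ' δ')
    (hγ : ∀ n, γ n ∈ Icc (γ' - Real.pi) (γ' + Real.pi))
    (hk : ∀ n, IsMatching (boundaryPt (φ n)) (boundaryPt φ') (γ n) (δ n) (α n + 2 * Real.pi) γ' δ'
      (α' + 2 * Real.pi) (ε n) (k n))
    (hε : Tendsto ε atTop (𝓝 0))
    (hb : Tendsto (fun n => boundaryPt (φ n) (β n)) atTop (𝓝 (boundaryPt φ' β'))) :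
    ∃ κ : ℕ → ℕ, Tendsto (fun n => cardyPhi (α (κ n)) (γ (κ n)) (β (κ n)) (δ (κ n))) atTop
      (𝓝 (cardyPhi α' γ' β' δ')) := by
  have hpi := Real.pi_pos
  -- The bound `γ' + 3π` comes from `δ n < α n + 2π < γ n + 2π`.
  obtain ⟨⟨C, d₀, a₀⟩, hmem, κ₁, hκ₁, hlim⟩ :=
    ((isCompact_Icc (a := γ' - Real.pi) (b := γ' + Real.pi)).prod
      ((isCompact_Icc (a := γ' - Real.pi) (b := γ' + 3 * Real.pi)).prod
        (isCompact_Icc (a := γ' - Real.pi) (b := γ' + 3 * Real.pi)))).tendsto_subseq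
      (x := fun n => (γ n, δ n, α n + 2 * Real.pi)) fun n => by
        have h1 := (hγ n).1
        have h2 := (hγ n).2
        have h3 := hαγ n
        have h4 := hδα n
        have h5 := (hβ n).1
        have h6 := (hβ n).2
        exact ⟨hγ n, ⟨by linarith, by linarith⟩, ⟨by linarith, by linarith⟩⟩
  obtain ⟨κ₂, hκ₂, K, hKm, -, hK⟩ := exists_subseq_tendsto_of_monotone
    (k := fun n => k (κ₁ n)) (fun n => (hk _).mono) (fun n t => (hk _).mem_Icc t)
  have hκ : Tendsto (fun n => κ₁ (κ₂ n)) atTop atTop := (hκ₁.comp hκ₂).tendsto_atTop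
  have hlim' := hlim.comp hκ₂.tendsto_atTop
  have hc : Tendsto (fun n => γ (κ₁ (κ₂ n))) atTop (𝓝 C) :=
    (continuous_fst.tendsto _).comp hlim'
  have hd : Tendsto (fun n => δ (κ₁ (κ₂ n))) atTop (𝓝 d₀) :=
    ((continuous_fst.comp continuous_snd).tendsto _).comp hlim'
  have ha : Tendsto (fun n => α (κ₁ (κ₂ n)) + 2 * Real.pi) atTop (𝓝 a₀) :=
    ((continuous_snd.comp continuous_snd).tendsto _).comp hlim'
  have h : ConvergentMatching (fun n => D (κ₁ (κ₂ n))) (fun n => φ (κ₁ (κ₂ n)))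
      (fun n => γ (κ₁ (κ₂ n))) (fun n => δ (κ₁ (κ₂ n))) (fun n => α (κ₁ (κ₂ n)) + 2 * Real.pi)
      D' φ' γ' δ' (α' + 2 * Real.pi) (fun n => ε (κ₁ (κ₂ n))) (fun n => k (κ₁ (κ₂ n))) C K :=
    { dom := fun n => hD _
      map := fun n => hφ _
      dom' := hA.domain
      map' := hA.riemannMap
      matching := fun n => hk _
      tendsto_eps := hε.comp hκ
      tendsto_c := hc
      mono := hKm
      tendsto_k := hK }
  have hC : C = γ' := h.C_eq hA hmem.1
  obtain ⟨rfl, rfl⟩ := h.limits_eq hA hC hd ha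
  subst hC
  have hβt : Tendsto (fun n => β (κ₁ (κ₂ n))) atTop (𝓝 β') :=
    h.tendsto_of_tendsto_boundaryPt hA rfl hβ' (fun n => (hβ _).1.le) (fun n => (hβ _).2.le)
      (fun n => by linarith [hαγ (κ₁ (κ₂ n)), hδα (κ₁ (κ₂ n))]) (hb.comp hκ)
  have hαt : Tendsto (fun n => α (κ₁ (κ₂ n))) atTop (𝓝 α') := by
    simpa using ha.sub_const (2 * Real.pi)
  exact ⟨fun n => κ₁ (κ₂ n), tendsto_cardyPhi hαt hc hβt hd hA.lt_ac hβ'.1 hβ'.2 hA.lt_da⟩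

end Cardy

end

/-! ### Reduction of the theorem to normalized subsequences. -/

theorem mainTheorem12
    (D : ℕ → Set ℂ) (φ : ℕ → ℂ → ℂ) (α γ β δ : ℕ → ℝ)
    (D' : Set ℂ) (φ' : ℂ → ℂ) (α' γ' β' δ' : ℝ)
    (hD : ∀ n, Cardy.IsAdmissible (D n) (φ n) (α n) (γ n) (δ n))
    (hβ : ∀ n, β n ∈ Set.Ioo (γ n) (δ n))
    (hD' : Cardy.IsAdmissible D' φ' α' γ' δ')
    (hβ' : β' ∈ Set.Ioo γ' δ')
    (hda : Filter.Tendsto (fun n => Cardy.curveDist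
      (Cardy.boundaryArc (φ n) (δ n) (α n + 2 * Real.pi))
      (Cardy.boundaryArc φ' δ' (α' + 2 * Real.pi))) Filter.atTop (nhds 0))
    (hac : Filter.Tendsto (fun n => Cardy.curveDist
      (Cardy.boundaryArc (φ n) (α n) (γ n))
      (Cardy.boundaryArc φ' α' γ')) Filter.atTop (nhds 0))
    (hcd : Filter.Tendsto (fun n => Cardy.curveDist
      (Cardy.boundaryArc (φ n) (γ n) (δ n))
      (Cardy.boundaryArc φ' γ' δ')) Filter.atTop (nhds 0))
    (hb : Filter.Tendsto (fun n => Cardy.boundaryPt (φ n) (β n)) Filter.atTop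
      (nhds (Cardy.boundaryPt φ' β'))) :
    Filter.Tendsto (fun n => Cardy.cardyPhi (α n) (γ n) (β n) (δ n)) Filter.atTop
      (nhds (Cardy.cardyPhi α' γ' β' δ')) := by
  refine tendsto_of_subseq_tendsto fun ns hns => ?_
  have hpos : ∀ j : ℕ, (0 : ENNReal) < ENNReal.ofReal (1 / ((j : ℝ) + 1)) := fun j =>
    ENNReal.ofReal_pos.2 Nat.one_div_pos_of_nat
  obtain ⟨κ, hκ, hclose⟩ := extraction_forall_of_eventually fun j =>
    ((hda.comp hns).eventually (gt_mem_nhds (hpos j))).and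
      (((hac.comp hns).eventually (gt_mem_nhds (hpos j))).and
        ((hcd.comp hns).eventually (gt_mem_nhds (hpos j))))
  set i : ℕ → ℕ := fun j => ns (κ j) with hi
  have hit : Tendsto i atTop atTop := hns.comp hκ.tendsto_atTop
  -- Arguments matter only modulo `2π`; a common shift of all four places that of `c` within `π` of
  -- `γ'` and changes neither the boundary points nor `cardyPhi`.
  have hex : ∀ j, ∃ m : ℤ, γ (i j) + m * (2 * Real.pi) ∈
      Ico (γ' - Real.pi) (γ' - Real.pi + 2 * Real.pi) := fun j => by
    obtain ⟨m, hm, -⟩ := existsUnique_add_zsmul_mem_Ico Real.two_pi_pos (γ (i j)) (γ' - Real.pi)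
    exact ⟨m, by simpa [zsmul_eq_mul] using hm⟩
  choose m hm using hex
  have hmatch : ∀ j, ∃ k, Cardy.IsMatching (Cardy.boundaryPt (φ (i j))) (Cardy.boundaryPt φ')
      (γ (i j) + m j * (2 * Real.pi)) (δ (i j) + m j * (2 * Real.pi))
      (α (i j) + m j * (2 * Real.pi) + 2 * Real.pi) γ' δ' (α' + 2 * Real.pi)
      (1 / ((j : ℝ) + 1)) k := fun j => by
    have h := hD (i j)
    obtain ⟨h1, h2, h3⟩ := hclose j
    refine Cardy.exists_isMatching (by linarith [h.lt_ac]) (by linarith [h.lt_cd])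
      (by linarith [h.lt_da]) hD'.lt_ac hD'.lt_cd hD'.lt_da ?_ ?_ ?_
    · rw [show α (i j) + m j * (2 * Real.pi) + 2 * Real.pi =
        α (i j) + 2 * Real.pi + m j * (2 * Real.pi) by ring, Cardy.boundaryArc_add_int_mul]
      exact h1
    · rw [Cardy.boundaryArc_add_int_mul]
      exact h2
    · rw [Cardy.boundaryArc_add_int_mul]
      exact h3
  choose k hk using hmatch
  obtain ⟨μ, hμ⟩ := Cardy.exists_subseq_tendsto_cardyPhi
    (D := fun j => D (i j)) (φ := fun j => φ (i j)) (α := fun j => α (i j) + m j * (2 * Real.pi))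
    (γ := fun j => γ (i j) + m j * (2 * Real.pi)) (β := fun j => β (i j) + m j * (2 * Real.pi))
    (δ := fun j => δ (i j) + m j * (2 * Real.pi))
    (fun j => (hD _).domain) (fun j => (hD _).riemannMap)
    (fun j => by linarith [(hD (i j)).lt_ac]) (fun j => by linarith [(hD (i j)).lt_da])
    (fun j => ⟨by linarith [(hβ (i j)).1], by linarith [(hβ (i j)).2]⟩) hD' hβ'
    (fun j => ⟨(hm j).1, by linarith [(hm j).2]⟩) hk tendsto_one_div_add_atTop_nhds_zero_nat
    (by simpa only [Cardy.boundaryPt_add_int_mul, Function.comp_def] using hb.comp hit)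
  refine ⟨fun n => κ (μ n), ?_⟩
  simpa only [Cardy.cardyPhi_add_int_mul] using hμ
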